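/- Let $H$ be a separable real Hilbert space and let $A$ be a selfadjoint operator on $H$ with $\langle Ax,x\rangle\ge c\|x\|^2$ on $\mathcal D(A)$ for some $c>0$ and with $\mathcal D(A)$ (normed by $\|A\cdot\|$) compactly embedded in $H$. For $r\ge 0$ put $H^r=\mathcal D(A^{r/4})$, $\|u\|_r=\|A^{r/4}u\|$, and let $H^{-r}$ be the dual space of $H^r$. Let $\mathcal H=H^2\times H\times H$, with $\|(u,v,\theta)\|_{\mathcal H}^2=\|u\|_2^2+\|v\|^2+\|\theta\|^2$. Let $\mathbb R^+=[0,\infty)$ and $\beta\in\mathbb R$. Consider weak solutions $(u,\partial_tu,\theta)\in C(\mathbb R^+,\mathcal H)$ (both equations being tested with the elements of $H^2$) of $$\partial_{tt}u+Au-A^{1/2}\theta+(\beta+\|u\|_1^2)A^{1/2}u=f(t),\qquad \partial_t\theta+A^{1/2}\theta+A^{1/2}\partial_tu=g(t),\qquad t>0,$$ and their energy $$\mathcal E(t)=\tfrac12\|(u(t),\partial_tu(t),\theta(t))\|_{\mathcal H}^2+\tfrac14\big(\beta+\|u(t)\|_1^2\big)^2 .$$ **Theorem.** Let $f\in L^\infty(\mathbb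 R^+,H)$, and let its distributional derivative $\partial_tf$ and $g$ be translation bounded functions in $L^2_{\rm loc}(\mathbb R^+,H^{-1})$, that is, $$\sup_{t\ge0}\int_t^{t+1}\big\{\|\partial_tf(\tau)\|_{-1}^2+\|g(\tau)\|_{-1}^2\big\}\,d\tau<\infty .$$ Then there is $R_0>0$ with the following property: for every $R\ge0$ there is $t_0=t_0(R)\ge0$ such that every weak solution with $\mathcal E(0)\le R$ satisfies $\mathcal E(t)\le R_0$ for all $t\ge t_0$. In particular an absorbing set exists: $t_0(R)$ and $R_0$ can be chosen so that, moreover, $\|(u(0),\partial_tu(0),\theta(0))\|_{\mathcal H}\le R$ implies $\|(u(t),\partial_tu(t),\theta(t))\|_{\mathcal H}\le R_0$ for all $t\ge t_0(R)$. Both $R_0$ and $t_0$ are given by explicit formulas: there is an absolute constant $N\in\mathbb N$ (independent of $H,A,c,\beta,f,g$) such that, whenever $F\ge0$ and $Q\ge 0$ are upper bounds of $\|f\|_{L^\infty(\mathbb R^+,H)}$ and of the supremum above, one can take, with $M=2+|\beta|+c^{-1}+F+Q$, $$R_0=M^N,\qquad t_0(R)=\big(M(1+R)\big)^N .$$ 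-/

import Mathlib

open MeasureTheory Set
open scoped ENNReal ContDiff InnerProductSpace

noncomputable section

section Scale

variable {H : Type*} [NormedAddCommGroup H] [InnerProductSpace ℝ H]

/-- `A` is a strictly positive selfadjoint (unbounded, densely defined) operator on `H`, with lower
bound `c > 0`, whose domain, normed by `x ↦ ‖A x‖`, is compactly embedded in `H`. -/
structure IsStrictlyPositiveOp [CompleteSpace H] (A : H →ₗ.[ℝ] H) (c : ℝ) : Prop where
  selfAdjoint : IsSelfAdjoint A
  pos : 0 < c
  lower_bound : ∀ x : A.domain, c * ‖(x : H)‖ ^ 2 ≤ ⟪A x, (x : H)⟫_ℝ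
  compact_embedding : IsCompact (closure {y : H | ∃ x : A.domain, (x : H) = y ∧ ‖A x‖ ≤ 1})

/-- The eigenspace `{x ∈ D(A) : A x = μ x}`. -/
def opEigenspace (A : H →ₗ.[ℝ] H) (μ : ℝ) : Submodule ℝ H where
  carrier := {x | ∃ h : x ∈ A.domain, A ⟨x, h⟩ = μ • x}
  zero_mem' := ⟨A.domain.zero_mem, by
    have : (⟨0, A.domain.zero_mem⟩ : A.domain) = 0 := rfl
    rw [this, LinearPMap.map_zero, smul_zero]⟩
  add_mem' := by
    rintro x y ⟨hx, ex⟩ ⟨hy, ey⟩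
    refine ⟨A.domain.add_mem hx hy, ?_⟩
    have : (⟨x + y, A.domain.add_mem hx hy⟩ : A.domain) = ⟨x, hx⟩ + ⟨y, hy⟩ := rfl
    rw [this, LinearPMap.map_add, ex, ey, smul_add]
  smul_mem' := by
    rintro a x ⟨hx, ex⟩
    refine ⟨A.domain.smul_mem a hx, ?_⟩
    have : (⟨a • x, A.domain.smul_mem a hx⟩ : A.domain) = a • ⟨x, hx⟩ := rfl
    rw [this, LinearPMap.map_smul, ex, smul_comm]

variable [CompleteSpace H]

/-- The spectral projection of `A` at `μ`: the orthogonal projection of `H` onto the eigenspace.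
(The eigenspaces of a selfadjoint operator are closed, so taking the closure changes nothing.) -/
def spectralProj (A : H →ₗ.[ℝ] H) (μ : ℝ) : H →L[ℝ] H :=
  (opEigenspace A μ).topologicalClosure.starProjection

/-- The real power `A ^ s`, by the spectral decomposition of `A` (which is pure point, since the
domain of `A` is compactly embedded): `A ^ s x = ∑ μ ^ s P_μ x`, the sum being over the eigenvalues
`μ` of `A` (the other terms vanish), and the domain consists of those `x` for which the orthogonal
series converges unconditionally in `H`, i.e. `∑ μ ^ (2 s) ‖P_μ x‖² < ∞`. -/
def opPow (A : H →ₗ.[ℝ] H) (s : ℝ) : H →ₗ.[ℝ] H where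
  domain :=
    { carrier := {x | Summable fun μ : ℝ => μ ^ s • spectralProj A μ x}
      zero_mem' := by simp
      add_mem' := by
        intro x y hx hy
        simpa [smul_add] using Summable.add hx hy
      smul_mem' := by
        intro a x hx
        simpa [smul_comm a] using Summable.const_smul a hx }
  toFun :=
    { toFun := fun x => ∑' μ : ℝ, μ ^ s • spectralProj A μ (x : H)
      map_add' := by
        intro x y
        have h := Summable.tsum_add x.2 y.2
        simpa [smul_add] using h
      map_smul' := by
        intro a x
        have h := Summable.tsum_const_smul a x.2
        simpa [smul_comm a] using h }

/-- The space `H^r = D(A^{r/4})`, `r ≥ 0`, normed by `‖u‖_r = ‖A^{r/4} u‖`. -/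
def HScale (A : H →ₗ.[ℝ] H) (r : ℝ) : Type _ := (opPow A (r / 4)).domain

instance (A : H →ₗ.[ℝ] H) (r : ℝ) : AddCommGroup (HScale A r) :=
  inferInstanceAs (AddCommGroup (opPow A (r / 4)).domain)

instance (A : H →ₗ.[ℝ] H) (r : ℝ) : Module ℝ (HScale A r) :=
  inferInstanceAs (Module ℝ (opPow A (r / 4)).domain)

/-- The operator `A^{r/4} : H^r → H`. -/
def HScale.root {A : H →ₗ.[ℝ] H} {r : ℝ} : HScale A r →ₗ[ℝ] H := (opPow A (r / 4)).toFun

/-- The inclusion `H^r → H`. -/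
def HScale.incl {A : H →ₗ.[ℝ] H} {r : ℝ} : HScale A r →ₗ[ℝ] H :=
  (opPow A (r / 4)).domain.subtype

/-- The norm `‖u‖_r = ‖A^{r/4} u‖` of `H^r`. -/
instance (A : H →ₗ.[ℝ] H) (r : ℝ) : SeminormedAddCommGroup (HScale A r) :=
  SeminormedAddCommGroup.induced (HScale A r) H HScale.root

instance (A : H →ₗ.[ℝ] H) (r : ℝ) : NormedSpace ℝ (HScale A r) :=
  NormedSpace.induced ℝ (HScale A r) H HScale.root

/-- The space `H^{-r}`, `r > 0`: the dual space of `H^r`, with the dual norm. -/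
abbrev HScaleDual (A : H →ₗ.[ℝ] H) (r : ℝ) : Type _ := StrongDual ℝ (HScale A r)

/-- `F` bounds the norm of `f` in `L^∞(ℝ⁺, H)`. -/
def EssBoundedBy (f : ℝ → H) (F : ℝ) : Prop :=
  AEStronglyMeasurable f (volume.restrict (Ici 0)) ∧
    ∀ᵐ t ∂(volume.restrict (Ici (0 : ℝ))), ‖f t‖ ≤ F

/-- `f'` is the derivative `∂_t f` of `f` on `(0, ∞)` in the sense of distributions with values in
`H^{-1}`, where `f t ∈ H` is viewed in `H^{-1}` as the functional `w ↦ ⟨f t, w⟩`. -/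
def IsDistribDeriv (A : H →ₗ.[ℝ] H) (f : ℝ → H) (f' : ℝ → HScaleDual A 1) : Prop :=
  ∀ (w : HScale A 1) (φ : ℝ → ℝ), ContDiff ℝ ∞ φ → HasCompactSupport φ → tsupport φ ⊆ Ioi 0 →
    ∫ t in Ioi (0 : ℝ), deriv φ t * ⟪f t, w.incl⟫_ℝ = -∫ t in Ioi (0 : ℝ), φ t * f' t w

/-- The functions `f'` and `g` are in `L²_loc(ℝ⁺, H^{-1})` and translation bounded there:
`sup_{t ≥ 0} ∫_t^{t+1} (‖f'(τ)‖²_{-1} + ‖g(τ)‖²_{-1}) dτ ≤ Q`. -/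
def TranslationBoundedBy (A : H →ₗ.[ℝ] H) (f' g : ℝ → HScaleDual A 1) (Q : ℝ) : Prop :=
  AEStronglyMeasurable f' (volume.restrict (Ici 0)) ∧
  AEStronglyMeasurable g (volume.restrict (Ici 0)) ∧
    ∀ t : ℝ, 0 ≤ t →
      ∫⁻ τ in Icc t (t + 1), (‖f' τ‖ₑ ^ 2 + ‖g τ‖ₑ ^ 2) ≤ ENNReal.ofReal Q

/-- The quantity `‖x‖_1² = ‖A^{1/4} x‖²`, for `x ∈ H^2 ⊆ H^1`. -/
def normOneSq {A : H →ₗ.[ℝ] H} (x : HScale A 2) : ℝ :=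
  ‖∑' μ : ℝ, μ ^ (1 / 4 : ℝ) • spectralProj A μ x.incl‖ ^ 2

/-- `(u, v, θ) ∈ C(ℝ⁺, H^2 × H × H)` is a weak solution, with `v = ∂_t u`, of the system
`∂_tt u + A u - A^{1/2} θ + (β + ‖u‖_1²) A^{1/2} u = f`, `∂_t θ + A^{1/2} θ + A^{1/2} ∂_t u = g`
for `t > 0`, with initial data `(u 0, v 0, θ 0)`. Both equations are tested with an arbitrary
`w ∈ H^2 = D(A^{1/2})` and integrated in time; `HScale.root` is `A^{1/2}` on `H^2`. In the second
one, `w₁` is `w` seen as an element of `H^1`. -/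
structure IsWeakSolution (A : H →ₗ.[ℝ] H) (β : ℝ) (f : ℝ → H) (g : ℝ → HScaleDual A 1)
    (u : ℝ → HScale A 2) (v θ : ℝ → H) : Prop where
  continuousOn_u : ContinuousOn u (Ici 0)
  continuousOn_v : ContinuousOn v (Ici 0)
  continuousOn_θ : ContinuousOn θ (Ici 0)
  deriv_u : ∀ t : ℝ, 0 ≤ t → HasDerivWithinAt (fun s => (u s).incl) (v t) (Ici 0) t
  eq_u : ∀ (w : HScale A 2) (t : ℝ), 0 ≤ t →
    ⟪v t, w.incl⟫_ℝ = ⟪v 0, w.incl⟫_ℝ +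
      ∫ s in (0 : ℝ)..t, (-⟪(u s).root, w.root⟫_ℝ + ⟪θ s, w.root⟫_ℝ
        - (β + normOneSq (u s)) * ⟪(u s).root, w.incl⟫_ℝ + ⟪f s, w.incl⟫_ℝ)
  eq_θ : ∀ (w : HScale A 2) (w₁ : HScale A 1), w₁.incl = w.incl → ∀ t : ℝ, 0 ≤ t →
    ⟪θ t, w.incl⟫_ℝ = ⟪θ 0, w.incl⟫_ℝ +
      ∫ s in (0 : ℝ)..t, (-⟪θ s, w.root⟫_ℝ - ⟪v s, w.root⟫_ℝ + g s w₁)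

/-- The norm of `(u, v, θ)` in the phase space `H^2 × H × H`. -/
def phaseNorm {A : H →ₗ.[ℝ] H} (u : HScale A 2) (v θ : H) : ℝ :=
  Real.sqrt (‖u‖ ^ 2 + ‖v‖ ^ 2 + ‖θ‖ ^ 2)

/-- The energy `½ ‖(u, v, θ)‖² + ¼ (β + ‖u‖_1²)²`. -/
def energy {A : H →ₗ.[ℝ] H} (β : ℝ) (u : HScale A 2) (v θ : H) : ℝ :=
  1 / 2 * phaseNorm u v θ ^ 2 + 1 / 4 * (β + normOneSq u) ^ 2

end Scale

end

/-!
The proof works with the coordinates in an orthonormal basis of eigenvectors of `A`. Such a basis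
exists because `A⁻¹` is a compact selfadjoint operator (`IsStrictlyPositiveOp.exists_eigenbasis`).
A weak solution is only continuous in the phase space, so that the energy identity is not available
directly; but each of its coordinates is absolutely continuous, and for finitely many modes all
formal computations are legitimate almost everywhere. The identities of the infinite system are
never needed, only the inequality that remains in the limit of all modes
(`IsWeakSolution.energy_le_add_integral`).

The inequality concerns the Lyapunov functional
`E - ⟨f, u⟩ + ε (⟨u, v⟩ + 2 ⟨v, A^{-1/2} θ⟩)`. Subtracting `⟨f, u⟩` replaces the power `⟨f, v⟩` by
`-⟨∂ₜ f, u⟩`, which is of order `E^{1/4}` only, since `‖u‖₁` is controlled by the nonlinear part of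
the energy. Here the distributional derivative enters through the lemma of du Bois-Reymond
(`exists_eq_const_add_integral_of_distribDeriv`). The terms with `ε` spread the dissipation `‖θ‖₁²`
to `u` and `v`; the price is the cubic term `ε (β + ‖u‖₁²) ⟨u, θ⟩`, which is absorbed by `‖θ‖₁²` up
to `ε² E^{3/2}`. For the Lyapunov functional `Λ`, which is close to `E`, this gives, up to
constants, `d/dt Λ ≤ -ε E + ε² E^{3/2} + E^{1/4} q(t)` with `q` translation bounded in `L¹`
(`modal_rate_le`).

No fixed `ε` is good for all solutions, but `ε ∼ E^{-1/2}` is: while the energy is comparable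
to a large number `K`, it decreases at a speed of order `K^{1/2}`, up to an error that is small
compared with `K` (`IsWeakSolution.energy_le_sub`). Such a function cannot rise from `K` to `4 K`,
and it falls from `K` to `K / 2` within a time of order `K`; summing the geometric series of these
times gives the absorption time (`le_of_decreasing_at_large_values`). All constants are bounded by
powers of `M`.
-/

/-! ### Eigenvectors of a strictly positive operator -/

namespace IsStrictlyPositiveOp

variable {H : Type*} [NormedAddCommGroup H] [InnerProductSpace ℝ H] [CompleteSpace H]
  {A : H →ₗ.[ℝ] H} {c : ℝ}

theorem inner_map_left (hA : IsStrictlyPositiveOp A c) (x y : A.domain) :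
    ⟪A x, (y : H)⟫_ℝ = ⟪(x : H), A y⟫_ℝ := by
  have h := LinearPMap.adjoint_isFormalAdjoint hA.selfAdjoint.dense_domain
  rw [LinearPMap.isSelfAdjoint_def.mp hA.selfAdjoint] at h
  exact h x y

theorem norm_le_norm_map (hA : IsStrictlyPositiveOp A c) (x : A.domain) :
    c * ‖(x : H)‖ ≤ ‖A x‖ := by
  have h1 := hA.lower_bound x
  have h2 := real_inner_le_norm (A x) (x : H)
  rcases (norm_nonneg (x : H)).eq_or_lt with h | h
  · rw [← h]; simp
  · have : c * ‖(x : H)‖ * ‖(x : H)‖ ≤ ‖A x‖ * ‖(x : H)‖ := by nlinarith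
    exact le_of_mul_le_mul_right this h

theorem injective (hA : IsStrictlyPositiveOp A c) : Function.Injective A.toFun := by
  rw [injective_iff_map_eq_zero]
  intro x hx
  have h := hA.norm_le_norm_map x
  have h0 : A x = 0 := hx
  rw [h0, norm_zero] at h
  have : ‖(x : H)‖ ≤ 0 := by
    by_contra hc
    push Not at hc
    have := mul_pos hA.pos hc
    linarith
  exact Subtype.ext (norm_le_zero_iff.mp this)

theorem isClosed_range (hA : IsStrictlyPositiveOp A c) :
    IsClosed (LinearMap.range A.toFun : Set H) := by
  rw [← isSeqClosed_iff_isClosed]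
  intro y y₀ hy hlim
  choose x hx using hy
  have hx' : ∀ n, A (x n) = y n := hx
  have hcau : CauchySeq fun n => (x n : H) := by
    rw [Metric.cauchySeq_iff']
    intro ε hε
    obtain ⟨N, hN⟩ := (Metric.cauchySeq_iff'.mp hlim.cauchySeq) (c * ε) (mul_pos hA.pos hε)
    refine ⟨N, fun n hn => ?_⟩
    have h1 := hA.norm_le_norm_map (x n - x N)
    rw [LinearPMap.map_sub, hx', hx', ← dist_eq_norm, Submodule.coe_sub, ← dist_eq_norm] at h1
    exact lt_of_mul_lt_mul_left (h1.trans_lt (hN n hn)) hA.pos.le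
  obtain ⟨x₀, hx₀⟩ := cauchySeq_tendsto_of_complete hcau
  have hcl : IsClosed (A.graph : Set (H × H)) := hA.selfAdjoint.isClosed
  have hmem : (x₀, y₀) ∈ A.graph := by
    refine hcl.mem_of_tendsto (hx₀.prodMk_nhds hlim) (Filter.Eventually.of_forall fun n => ?_)
    rw [SetLike.mem_coe, LinearPMap.mem_graph_iff]
    exact ⟨x n, rfl, hx' n⟩
  rw [LinearPMap.mem_graph_iff] at hmem
  obtain ⟨z, -, hz⟩ := hmem
  exact ⟨z, hz⟩

/-- The range is closed by the lower bound, and dense because a vector orthogonal to it lies in the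
kernel of the adjoint. -/
theorem surjective (hA : IsStrictlyPositiveOp A c) : Function.Surjective A.toFun := by
  have hcl := hA.isClosed_range
  rw [← LinearMap.range_eq_top]
  have : CompleteSpace (LinearMap.range A.toFun) := hcl.completeSpace_coe
  rw [← Submodule.orthogonal_eq_bot_iff, Submodule.eq_bot_iff]
  intro y hy
  rw [Submodule.mem_orthogonal'] at hy
  have hy0 : ∀ x : A.domain, ⟪y, A x⟫_ℝ = 0 := fun x => hy _ ⟨x, rfl⟩
  have hd := hA.selfAdjoint.dense_domain
  have hs := LinearPMap.isSelfAdjoint_def.mp hA.selfAdjoint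
  have hmem : y ∈ A.domain := by
    rw [← hs]
    exact LinearPMap.mem_adjoint_domain_of_exists y ⟨0, fun x => by rw [hy0]; simp⟩
  obtain ⟨z, hz⟩ : ∃ z : A.domain, (z : H) = y := ⟨⟨y, hmem⟩, rfl⟩
  have h1 := hA.lower_bound z
  rw [real_inner_comm, hz, hy0] at h1
  have : ‖y‖ ^ 2 ≤ 0 := by
    by_contra hc
    push Not at hc
    have := mul_pos hA.pos hc
    linarith
  have h3 : ‖y‖ = 0 := by
    have := sq_nonneg ‖y‖
    exact pow_eq_zero_iff (two_ne_zero) |>.mp (le_antisymm ‹_› this)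
  exact norm_eq_zero.mp h3

/-- The bounded inverse of `A`, stated through its defining property. -/
theorem exists_inverse (hA : IsStrictlyPositiveOp A c) :
    ∃ T : H →L[ℝ] H, ∀ y, ∃ h : T y ∈ A.domain, A ⟨T y, h⟩ = y := by
  let e : A.domain ≃ₗ[ℝ] H := LinearEquiv.ofBijective A.toFun ⟨hA.injective, hA.surjective⟩
  have he : ∀ y, A (e.symm y) = y := fun y => e.apply_symm_apply y
  refine ⟨(A.domain.subtype.comp e.symm.toLinearMap).mkContinuous c⁻¹ fun y => ?_, fun y => ?_⟩
  · have h := hA.norm_le_norm_map (e.symm y)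
    rw [he] at h
    rw [inv_mul_eq_div, le_div_iff₀ hA.pos, mul_comm]
    exact h
  · exact ⟨(e.symm y).2, he y⟩

theorem isSymmetric_inverse {T : H →L[ℝ] H} (hT : ∀ y, ∃ h : T y ∈ A.domain, A ⟨T y, h⟩ = y)
    (hA : IsStrictlyPositiveOp A c) : (T : H →ₗ[ℝ] H).IsSymmetric := by
  intro x y
  obtain ⟨hx, ex⟩ := hT x
  obtain ⟨hy, ey⟩ := hT y
  have h := hA.inner_map_left ⟨T x, hx⟩ ⟨T y, hy⟩
  rw [ex, ey] at h
  exact h.symm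

theorem isCompactOperator_inverse {T : H →L[ℝ] H}
    (hT : ∀ y, ∃ h : T y ∈ A.domain, A ⟨T y, h⟩ = y) (hA : IsStrictlyPositiveOp A c) :
    IsCompactOperator T := by
  refine (isCompactOperator_iff_image_closedBall_subset_compact (T : H →ₗ[ℝ] H)
    one_pos).mpr ⟨_, hA.compact_embedding, ?_⟩
  rintro _ ⟨y, hy, rfl⟩
  obtain ⟨h, e⟩ := hT y
  refine subset_closure ⟨⟨T y, h⟩, rfl, ?_⟩
  rw [e]
  simpa using hy

omit [CompleteSpace H] in
theorem mem_opEigenspace_of_inverse {T : H →L[ℝ] H}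
    (hT : ∀ y, ∃ h : T y ∈ A.domain, A ⟨T y, h⟩ = y) {ν : ℝ} (hν : ν ≠ 0) {x : H}
    (hx : T x = ν • x) : x ∈ opEigenspace A ν⁻¹ := by
  obtain ⟨h, e⟩ := hT x
  have hxm : x ∈ A.domain := by
    rw [hx] at h
    simpa [smul_smul, hν] using A.domain.smul_mem ν⁻¹ h
  refine ⟨hxm, ?_⟩
  have h2 : (⟨T x, h⟩ : A.domain) = ν • ⟨x, hxm⟩ := Subtype.ext hx
  rw [h2, LinearPMap.map_smul] at e
  conv_rhs => rw [← e]
  rw [smul_smul, inv_mul_cancel₀ hν, one_smul]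

/-- The lower bound `c` of `A` bounds its eigenvalues. -/
theorem le_of_mem_opEigenspace (hA : IsStrictlyPositiveOp A c) {μ : ℝ} {x : H}
    (hx : x ∈ opEigenspace A μ) (h0 : ‖x‖ = 1) : c ≤ μ := by
  obtain ⟨h, e⟩ := hx
  have h1 := hA.lower_bound ⟨x, h⟩
  rw [e, real_inner_smul_left, real_inner_self_eq_norm_sq, h0] at h1
  simpa using h1

theorem inner_eq_zero_of_mem_opEigenspace (hA : IsStrictlyPositiveOp A c) {μ ν : ℝ} (hμν : μ ≠ ν)
    {x y : H} (hx : x ∈ opEigenspace A μ) (hy : y ∈ opEigenspace A ν) : ⟪x, y⟫_ℝ = 0 := by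
  obtain ⟨hx, ex⟩ := hx
  obtain ⟨hy, ey⟩ := hy
  have h := hA.inner_map_left ⟨x, hx⟩ ⟨y, hy⟩
  rw [ex, ey, real_inner_smul_left, real_inner_smul_right] at h
  have : (μ - ν) * ⟪x, y⟫_ℝ = 0 := by linarith
  exact (mul_eq_zero.mp this).resolve_left (sub_ne_zero.mpr hμν)

end IsStrictlyPositiveOp

/-- An orthonormal family in a separable inner product space is countable: its members are at
mutual distance `√2`. -/
theorem Orthonormal.countable_of_separable {ι E : Type*} [NormedAddCommGroup E]
    [InnerProductSpace ℝ E] [TopologicalSpace.SeparableSpace E] {v : ι → E}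
    (hv : Orthonormal ℝ v) : Countable ι := by
  refine Pairwise.countable_of_isOpen_disjoint (s := fun i => Metric.ball (v i) (1 / 2)) ?_
    (fun i => Metric.isOpen_ball) (fun i => ⟨v i, Metric.mem_ball_self (by norm_num)⟩)
  intro i j hij
  refine Metric.ball_disjoint_ball ?_
  have h : ‖v i - v j‖ ^ 2 = 2 := by
    rw [@norm_sub_sq_real, hv.1 i, hv.1 j, hv.2 hij]; norm_num
  rw [dist_eq_norm]
  nlinarith [norm_nonneg (v i - v j)]

/-- Spectral theorem for an operator with compactly embedded domain: there is an orthonormal basis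
of eigenvectors. -/
theorem IsStrictlyPositiveOp.exists_eigenbasis {H : Type*} [NormedAddCommGroup H]
    [InnerProductSpace ℝ H] [CompleteSpace H] {A : H →ₗ.[ℝ] H} {c : ℝ}
    (hA : IsStrictlyPositiveOp A c) :
    ∃ (s : Set H) (b : HilbertBasis s ℝ H) (lam : s → ℝ),
      (∀ i, c ≤ lam i) ∧ ∀ i, b i ∈ opEigenspace A (lam i) := by
  obtain ⟨T, hT⟩ := hA.exists_inverse
  have hsym := isSymmetric_inverse hT hA
  have hbot := ContinuousLinearMap.orthogonalComplement_iSup_eigenspaces_eq_bot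
    (isCompactOperator_inverse hT hA) hsym
  have hinj : ∀ x, T x = 0 → x = 0 := by
    intro x hx
    obtain ⟨h, e⟩ := hT x
    have : (⟨T x, h⟩ : A.domain) = 0 := Subtype.ext hx
    rw [this, LinearPMap.map_zero] at e
    exact e.symm
  have hcl : ∀ ν : ℝ, IsClosed (Module.End.eigenspace (T : Module.End ℝ H) ν : Set H) := by
    intro ν
    have : (Module.End.eigenspace (T : Module.End ℝ H) ν : Set H) = {x | T x = ν • x} := by
      ext x; simp
    rw [this]
    exact isClosed_eq T.continuous (continuous_const_smul ν)
  have hcomp : ∀ ν : ℝ, CompleteSpace (Module.End.eigenspace (T : Module.End ℝ H) ν) :=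
    fun ν => (hcl ν).completeSpace_coe
  choose w bw hbw using fun ν : ℝ =>
    exists_hilbertBasis ℝ (Module.End.eigenspace (T : Module.End ℝ H) ν)
  have hortho := (hsym.orthogonalFamily_eigenspaces).orthonormal_sigma_orthonormal
    (v_family := fun ν (i : w ν) => bw ν i) (fun ν => (bw ν).orthonormal)
  set v : (Σ ν : ℝ, w ν) → H := fun p => ((bw p.1 p.2 : Module.End.eigenspace _ p.1) : H) with hv
  have hov : Orthonormal ℝ v := hortho
  have hrange := hov.toSubtypeRange
  have hsp : (Submodule.span ℝ (range (Subtype.val : range v → H)))ᗮ = ⊥ := by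
    rw [Subtype.range_coe, ← hbot]
    refine le_antisymm ?_ ?_
    · intro x hx
      rw [← Submodule.iInf_orthogonal, Submodule.mem_iInf]
      intro ν
      rw [Submodule.mem_orthogonal]
      intro y hy
      have h1 := (bw ν).hasSum_repr ⟨y, hy⟩
      have h2 := (h1.mapL (Submodule.subtypeL _)).mapL (innerSL ℝ x)
      have h3 : ∀ i, ⟪x, ((bw ν i : Module.End.eigenspace _ ν) : H)⟫_ℝ = 0 := by
        intro i
        rw [real_inner_comm]
        exact (Submodule.mem_orthogonal _ x).mp hx _ (Submodule.subset_span ⟨⟨ν, i⟩, rfl⟩)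
      have h4 := h2.unique (by
        convert hasSum_zero using 2 with i
        simp [h3])
      rw [real_inner_comm]
      simpa using h4
    · rw [hbot]; exact bot_le
  have hmem : ∀ i : range v, ∃ μ : ℝ, (i : H) ∈ opEigenspace A μ := by
    rintro ⟨_, p, rfl⟩
    have hp := (bw p.1 p.2).2
    rw [Module.End.mem_eigenspace_iff] at hp
    refine ⟨_, mem_opEigenspace_of_inverse hT ?_ hp⟩
    intro h0
    have h1 := hinj (v p) (by have : T (v p) = p.1 • v p := hp
                              rw [this, h0, zero_smul])
    have h2 := hov.1 p
    rw [h1] at h2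
    simp at h2
  choose lam hlam using hmem
  have hb := HilbertBasis.coe_mkOfOrthogonalEqBot hrange hsp
  refine ⟨range v, HilbertBasis.mkOfOrthogonalEqBot hrange hsp, lam, fun i => ?_, fun i => ?_⟩
  · exact hA.le_of_mem_opEigenspace (hlam i) (hrange.1 i)
  · rw [hb]; exact hlam i

/-! ### Coordinates in an eigenbasis -/

/-- `b` is an orthonormal basis of eigenvectors of the strictly positive operator `A`, with
eigenvalues `lam`. -/
structure IsEigenbasis {H : Type*} [NormedAddCommGroup H] [InnerProductSpace ℝ H] [CompleteSpace H]
    (A : H →ₗ.[ℝ] H) (c : ℝ) {ι : Type*} (b : HilbertBasis ι ℝ H) (lam : ι → ℝ) : Prop where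
  op : IsStrictlyPositiveOp A c
  le_lam : ∀ i, c ≤ lam i
  mem : ∀ i, b i ∈ opEigenspace A (lam i)

namespace IsEigenbasis

variable {H : Type*} [NormedAddCommGroup H] [InnerProductSpace ℝ H] [CompleteSpace H]
  {A : H →ₗ.[ℝ] H} {c : ℝ} {ι : Type*} {b : HilbertBasis ι ℝ H} {lam : ι → ℝ}

theorem lam_pos (h : IsEigenbasis A c b lam) (i : ι) : 0 < lam i :=
  h.op.pos.trans_le (h.le_lam i)

theorem spectralProj_basis_self (h : IsEigenbasis A c b lam) (i : ι) :
    spectralProj A (lam i) (b i) = b i :=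
  Submodule.starProjection_eq_self_iff.mpr (Submodule.le_topologicalClosure _ (h.mem i))

theorem spectralProj_basis_of_ne (h : IsEigenbasis A c b lam) {i : ι} {μ : ℝ} (hμ : μ ≠ lam i) :
    spectralProj A μ (b i) = 0 := by
  rw [spectralProj, Submodule.starProjection_apply_eq_zero_iff, Submodule.orthogonal_closure,
    Submodule.mem_orthogonal]
  exact fun x hx => h.op.inner_eq_zero_of_mem_opEigenspace hμ hx (h.mem i)

/-- Spectral projections are symmetric. -/
theorem inner_spectralProj (A : H →ₗ.[ℝ] H) (μ : ℝ) (x y : H) :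
    ⟪x, spectralProj A μ y⟫_ℝ = ⟪spectralProj A μ x, y⟫_ℝ :=
  (Submodule.inner_starProjection_left_eq_right _ x y).symm

/-- The function of `A` given by `φ` acts on the coordinates as multiplication by `φ (lam i)`. -/
theorem inner_basis_tsum (h : IsEigenbasis A c b lam) (φ : ℝ → ℝ) {x : H}
    (hx : Summable fun μ : ℝ => φ μ • spectralProj A μ x) (i : ι) :
    ⟪b i, ∑' μ : ℝ, φ μ • spectralProj A μ x⟫_ℝ = φ (lam i) * ⟪b i, x⟫_ℝ := by
  have h1 := (hx.hasSum.mapL (innerSL ℝ (b i))).tsum_eq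
  rw [innerSL_apply_apply] at h1
  rw [← h1, tsum_eq_single (lam i)]
  · rw [innerSL_apply_apply, real_inner_smul_right, inner_spectralProj, h.spectralProj_basis_self]
  · intro μ hμ
    rw [innerSL_apply_apply, real_inner_smul_right, inner_spectralProj,
      h.spectralProj_basis_of_ne hμ, inner_zero_left, mul_zero]

omit [CompleteSpace H] in
theorem eq_zero_of_inner_basis (b : HilbertBasis ι ℝ H) {x : H} (hx : ∀ i, ⟪b i, x⟫_ℝ = 0) :
    x = 0 := by
  have h1 := b.hasSum_inner_mul_inner x x
  simp only [hx, mul_zero] at h1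
  exact inner_self_eq_zero.mp (h1.unique hasSum_zero)

/-- There is no spectrum below the lower bound `c`. -/
theorem spectralProj_eq_zero (h : IsEigenbasis A c b lam) {μ : ℝ} (hμ : μ < c) (x : H) :
    spectralProj A μ x = 0 := by
  refine eq_zero_of_inner_basis b fun i => ?_
  rw [inner_spectralProj, h.spectralProj_basis_of_ne (hμ.trans_le (h.le_lam i)).ne,
    inner_zero_left]

theorem summable_smul_spectralProj_basis (h : IsEigenbasis A c b lam) (φ : ℝ → ℝ) (i : ι) :
    Summable fun μ : ℝ => φ μ • spectralProj A μ (b i) :=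
  summable_of_ne_finset_zero (s := {lam i}) fun μ hμ => by
    rw [h.spectralProj_basis_of_ne (by simpa using hμ), smul_zero]

theorem tsum_smul_spectralProj_basis (h : IsEigenbasis A c b lam) (φ : ℝ → ℝ) (i : ι) :
    ∑' μ : ℝ, φ μ • spectralProj A μ (b i) = φ (lam i) • b i := by
  rw [tsum_eq_single (lam i), h.spectralProj_basis_self]
  intro μ hμ
  rw [h.spectralProj_basis_of_ne hμ, smul_zero]

theorem orthogonalFamily (hA : IsStrictlyPositiveOp A c) :
    OrthogonalFamily ℝ (fun μ : ℝ => (opEigenspace A μ).topologicalClosure)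
      fun μ => ((opEigenspace A μ).topologicalClosure).subtypeₗᵢ := by
  intro μ ν hμν x y
  have h1 : opEigenspace A μ ≤ (opEigenspace A ν)ᗮ := by
    intro z hz
    rw [Submodule.mem_orthogonal]
    exact fun z' hz' => hA.inner_eq_zero_of_mem_opEigenspace hμν.symm hz' hz
  have h2 : (opEigenspace A μ).topologicalClosure ≤ ((opEigenspace A ν).topologicalClosure)ᗮ := by
    rw [Submodule.orthogonal_closure]
    exact Submodule.topologicalClosure_minimal _ h1 (Submodule.isClosed_orthogonal _)
  exact Submodule.inner_left_of_mem_orthogonal y.2 (h2 x.2)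

/-- Since the terms `φ μ P_μ x` are mutually orthogonal, their unconditional convergence amounts to
that of the sum of the squared norms. -/
theorem summable_smul_spectralProj_iff (hA : IsStrictlyPositiveOp A c) (φ : ℝ → ℝ) (x : H) :
    (Summable fun μ : ℝ => φ μ • spectralProj A μ x) ↔
      Summable fun μ : ℝ => ‖φ μ • spectralProj A μ x‖ ^ 2 :=
  (orthogonalFamily hA).summable_iff_norm_sq_summable fun μ =>
    ⟨φ μ • spectralProj A μ x, Submodule.smul_mem _ _ (Submodule.starProjection_apply_mem _ _)⟩

/-- `D(A ^ s) ⊆ D(A ^ r)` for `r ≤ s`. In particular the series that defines `normOneSq` converges on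
`H^2`, so that it has no junk value. -/
theorem summable_rpow_mono (h : IsEigenbasis A c b lam) {r s : ℝ} (hrs : r ≤ s) {x : H}
    (hx : Summable fun μ : ℝ => μ ^ s • spectralProj A μ x) :
    Summable fun μ : ℝ => μ ^ r • spectralProj A μ x := by
  rw [summable_smul_spectralProj_iff h.op] at hx ⊢
  refine Summable.of_nonneg_of_le (fun _ => sq_nonneg _) (fun μ => ?_)
    (hx.mul_left ((c ^ (r - s)) ^ 2))
  rcases lt_or_ge μ c with hμ | hμ
  · rw [h.spectralProj_eq_zero hμ]; simp
  · have hμ0 := h.op.pos.trans_le hμ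
    rw [← mul_pow]
    refine pow_le_pow_left₀ (norm_nonneg _) ?_ 2
    rw [norm_smul, norm_smul, ← mul_assoc]
    refine mul_le_mul_of_nonneg_right ?_ (norm_nonneg _)
    rw [Real.norm_of_nonneg (Real.rpow_nonneg hμ0.le _),
      Real.norm_of_nonneg (Real.rpow_nonneg hμ0.le _)]
    calc μ ^ r = μ ^ (r - s) * μ ^ s := by rw [← Real.rpow_add hμ0]; ring_nf
      _ ≤ c ^ (r - s) * μ ^ s := by
        refine mul_le_mul_of_nonneg_right ?_ (Real.rpow_nonneg hμ0.le _)
        exact Real.rpow_le_rpow_of_nonpos h.op.pos hμ (by linarith)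

/-- The basis vector `b i` as an element of `H^r`. -/
noncomputable def vec (h : IsEigenbasis A c b lam) (r : ℝ) (i : ι) : HScale A r :=
  ⟨b i, h.summable_smul_spectralProj_basis _ i⟩

@[simp] theorem incl_vec (h : IsEigenbasis A c b lam) (r : ℝ) (i : ι) : (h.vec r i).incl = b i :=
  rfl

theorem root_vec (h : IsEigenbasis A c b lam) (r : ℝ) (i : ι) :
    (h.vec r i).root = lam i ^ (r / 4) • b i :=
  h.tsum_smul_spectralProj_basis _ i

theorem inner_root (h : IsEigenbasis A c b lam) {r : ℝ} (x : HScale A r) (i : ι) :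
    ⟪b i, x.root⟫_ℝ = lam i ^ (r / 4) * ⟪b i, x.incl⟫_ℝ :=
  h.inner_basis_tsum (fun μ => μ ^ (r / 4)) x.2 i

theorem norm_eq_norm_root {r : ℝ} (x : HScale A r) : ‖x‖ = ‖x.root‖ := rfl

omit [CompleteSpace H] in
theorem hasSum_sq (b : HilbertBasis ι ℝ H) (x : H) : HasSum (fun i => ⟪b i, x⟫_ℝ ^ 2) (‖x‖ ^ 2) := by
  have h := b.hasSum_inner_mul_inner x x
  rw [real_inner_self_eq_norm_sq] at h
  refine (funext fun i => ?_ : (fun i => ⟪x, b i⟫_ℝ * ⟪b i, x⟫_ℝ) = fun i => ⟪b i, x⟫_ℝ ^ 2) ▸ h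
  rw [real_inner_comm x (b i), sq]

theorem rpow_two_div_four (x : ℝ) : x ^ ((2 : ℝ) / 4) = √x := by
  rw [Real.sqrt_eq_rpow]; norm_num

theorem hasSum_norm_sq (h : IsEigenbasis A c b lam) (x : HScale A 2) :
    HasSum (fun i => (√(lam i) * ⟪b i, x.incl⟫_ℝ) ^ 2) (‖x‖ ^ 2) := by
  have h1 := hasSum_sq b x.root
  simp only [h.inner_root, rpow_two_div_four] at h1
  exact h1

theorem rpow_quarter_sq (h : IsEigenbasis A c b lam) (i : ι) :
    (lam i ^ ((1 : ℝ) / 4)) ^ 2 = √(lam i) := by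
  rw [sq, ← Real.rpow_add (h.lam_pos i), Real.sqrt_eq_rpow]
  norm_num

theorem hasSum_normOneSq (h : IsEigenbasis A c b lam) (x : HScale A 2) :
    HasSum (fun i => √(lam i) * ⟪b i, x.incl⟫_ℝ ^ 2) (normOneSq x) := by
  have hx : Summable fun μ : ℝ => μ ^ ((1 : ℝ) / 4) • spectralProj A μ x.incl :=
    h.summable_rpow_mono (by norm_num) x.2
  have h1 := hasSum_sq b (∑' μ : ℝ, μ ^ ((1 : ℝ) / 4) • spectralProj A μ x.incl)
  simp only [h.inner_basis_tsum (fun μ => μ ^ ((1 : ℝ) / 4)) hx] at h1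
  refine (funext fun i => ?_ : (fun i => (lam i ^ ((1 : ℝ) / 4) * ⟪b i, x.incl⟫_ℝ) ^ 2) =
    fun i => √(lam i) * ⟪b i, x.incl⟫_ℝ ^ 2) ▸ h1
  rw [mul_pow, h.rpow_quarter_sq]

theorem normOneSq_eq_inner (h : IsEigenbasis A c b lam) (x : HScale A 2) :
    normOneSq x = ⟪x.root, x.incl⟫_ℝ := by
  refine (h.hasSum_normOneSq x).unique ?_
  refine (funext fun i => ?_ : (fun i => ⟪x.root, b i⟫_ℝ * ⟪b i, x.incl⟫_ℝ) =
    fun i => √(lam i) * ⟪b i, x.incl⟫_ℝ ^ 2) ▸ b.hasSum_inner_mul_inner x.root x.incl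
  rw [real_inner_comm, h.inner_root, rpow_two_div_four]
  ring

theorem normOneSq_nonneg (x : HScale A 2) : 0 ≤ normOneSq x := sq_nonneg _

/-- The only way in which the lower bound of `A` enters the estimates. -/
theorem le_sqrt_lam (h : IsEigenbasis A c b lam) {M : ℝ} (hM : 1 ≤ M) (hc : c⁻¹ ≤ M) (i : ι) :
    1 ≤ M * √(lam i) := by
  have h1 : 1 ≤ M * lam i := by
    have h2 : 1 ≤ M * c := by
      have := mul_le_mul_of_nonneg_right hc h.op.pos.le
      rwa [inv_mul_cancel₀ h.op.pos.ne'] at this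
    exact h2.trans (mul_le_mul_of_nonneg_left (h.le_lam i) (by linarith))
  have h3 := Real.sq_sqrt (h.lam_pos i).le
  have h4 := Real.sqrt_nonneg (lam i)
  by_contra hcon
  push Not at hcon
  have h5 : (M * √(lam i)) * (M * √(lam i)) < 1 := by
    have : 0 ≤ M * √(lam i) := by positivity
    nlinarith
  nlinarith [mul_nonneg (sub_nonneg.mpr hM) (h.lam_pos i).le]

theorem norm_incl_le (h : IsEigenbasis A c b lam) {M : ℝ} (hM : 1 ≤ M) (hc : c⁻¹ ≤ M)
    (x : HScale A 2) : ‖x.incl‖ ≤ M * ‖x‖ := by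
  have h1 : ‖x.incl‖ ^ 2 ≤ (M * ‖x‖) ^ 2 := by
    rw [mul_pow]
    refine hasSum_le (fun i => ?_) (hasSum_sq b x.incl) ((h.hasSum_norm_sq x).mul_left (M ^ 2))
    have h2 := h.le_sqrt_lam hM hc i
    have h3 : 1 ≤ (M * √(lam i)) ^ 2 := one_le_pow₀ h2
    calc ⟪b i, x.incl⟫_ℝ ^ 2 ≤ (M * √(lam i)) ^ 2 * ⟪b i, x.incl⟫_ℝ ^ 2 :=
          le_mul_of_one_le_left (sq_nonneg _) h3
      _ = _ := by ring
  exact (sq_le_sq₀ (norm_nonneg _) (by positivity)).mp h1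

theorem continuous_incl (h : IsEigenbasis A c b lam) :
    Continuous (HScale.incl : HScale A 2 →ₗ[ℝ] H) := by
  have hM : 1 ≤ 1 + c⁻¹ := by have := inv_pos.mpr h.op.pos; linarith
  exact (HScale.incl.mkContinuous (1 + c⁻¹) (h.norm_incl_le hM (by linarith))).continuous

theorem continuous_root {r : ℝ} : Continuous (HScale.root : HScale A r →ₗ[ℝ] H) :=
  (HScale.root.mkContinuous 1 fun x => by rw [one_mul, norm_eq_norm_root]).continuous

theorem continuous_normOneSq (h : IsEigenbasis A c b lam) :
    Continuous (normOneSq : HScale A 2 → ℝ) := by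
  have : (normOneSq : HScale A 2 → ℝ) = fun x => ⟪x.root, x.incl⟫_ℝ :=
    funext h.normOneSq_eq_inner
  rw [this]
  exact continuous_root.inner h.continuous_incl

/-- The norm of `H^1` on a finite combination of the basis vectors. -/
theorem norm_sum_smul_vec (h : IsEigenbasis A c b lam) (S : Finset ι) (a : ι → ℝ) :
    ‖∑ i ∈ S, a i • h.vec 1 i‖ ^ 2 = ∑ i ∈ S, √(lam i) * a i ^ 2 := by
  have h1 : (∑ i ∈ S, a i • h.vec 1 i).root = ∑ i ∈ S, (a i * lam i ^ ((1 : ℝ) / 4)) • b i := by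
    rw [map_sum]
    refine Finset.sum_congr rfl fun i _ => ?_
    rw [map_smul, h.root_vec, smul_smul]
  rw [norm_eq_norm_root, h1, ← real_inner_self_eq_norm_sq, b.orthonormal.inner_sum]
  refine Finset.sum_congr rfl fun i _ => ?_
  rw [← h.rpow_quarter_sq]
  simp only [conj_trivial]
  ring

/-- An element of `H^{-1}`, tested with a finite combination of basis vectors, in coordinates. -/
theorem abs_sum_mul_dual_le (h : IsEigenbasis A c b lam) (S : Finset ι) (a : ι → ℝ)
    (g : HScaleDual A 1) :
    |∑ i ∈ S, a i * g (h.vec 1 i)| ≤ ‖g‖ * √(∑ i ∈ S, √(lam i) * a i ^ 2) := by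
  have h1 : ∑ i ∈ S, a i * g (h.vec 1 i) = g (∑ i ∈ S, a i • h.vec 1 i) := by
    simp [map_sum]
  rw [h1, ← h.norm_sum_smul_vec, Real.sqrt_sq (norm_nonneg _)]
  exact g.le_opNorm _

end IsEigenbasis

/-! ### The lemma of du Bois-Reymond on the half-line -/

theorem exists_tsupport_subset_Icc {φ : ℝ → ℝ} (hc : HasCompactSupport φ)
    (hs : tsupport φ ⊆ Ioi 0) : ∃ α T : ℝ, 0 < α ∧ α ≤ T ∧ tsupport φ ⊆ Icc α T := by
  rcases (tsupport φ).eq_empty_or_nonempty with h | h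
  · exact ⟨1, 1, one_pos, le_rfl, by simp [h]⟩
  · obtain ⟨α, hα⟩ := hc.isCompact.exists_isLeast h
    obtain ⟨T, hT⟩ := hc.isCompact.exists_isGreatest h
    exact ⟨α, T, hs hα.1, hα.2 hT.1, fun x hx => ⟨hα.2 hx, hT.2 hx⟩⟩

theorem setIntegral_Ioi_eq_intervalIntegral {φ : ℝ → ℝ} {T : ℝ} (hT : 0 ≤ T)
    (hs : ∀ t, T < t → φ t = 0) : ∫ t in Ioi (0 : ℝ), φ t = ∫ t in (0 : ℝ)..T, φ t := by
  rw [intervalIntegral.integral_of_le hT]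
  refine setIntegral_eq_of_subset_of_forall_sdiff_eq_zero measurableSet_Ioi
    (fun t ht => ht.1) fun t ht => hs t ?_
  by_contra hcon
  exact ht.2 ⟨ht.1, not_lt.mp hcon⟩

theorem apply_eq_zero_of_tsupport_subset {φ : ℝ → ℝ} {s : Set ℝ} (hs : tsupport φ ⊆ s) {t : ℝ}
    (ht : t ∉ s) : φ t = 0 :=
  image_eq_zero_of_notMem_tsupport fun h => ht (hs h)

/-- Integration by parts of a test function of the open half-line against a primitive. -/
theorem integral_deriv_mul_primitive {q : ℝ → ℝ}
    (hq : ∀ T, 0 ≤ T → IntervalIntegrable q volume 0 T) {φ : ℝ → ℝ} (hφ : ContDiff ℝ ∞ φ)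
    (hc : HasCompactSupport φ) (hs : tsupport φ ⊆ Ioi 0) :
    ∫ t in Ioi (0 : ℝ), deriv φ t * ∫ s in (0 : ℝ)..t, q s = -∫ t in Ioi (0 : ℝ), φ t * q t := by
  obtain ⟨α, T, hα, hαT, hsub⟩ := exists_tsupport_subset_Icc hc hs
  have hT : 0 ≤ T := hα.le.trans hαT
  have hφ0 : ∀ t, T < t → φ t = 0 := fun t ht =>
    apply_eq_zero_of_tsupport_subset hsub fun h => absurd h.2 (not_le.mpr ht)
  have hdφ0 : ∀ t, T < t → deriv φ t = 0 := fun t ht =>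
    apply_eq_zero_of_tsupport_subset (tsupport_deriv_subset.trans hsub)
      fun h => absurd h.2 (not_le.mpr ht)
  rw [setIntegral_Ioi_eq_intervalIntegral (T := T) hT (fun t ht => by rw [hdφ0 t ht, zero_mul]),
    setIntegral_Ioi_eq_intervalIntegral (T := T) hT (fun t ht => by rw [hφ0 t ht, zero_mul])]
  have hG := (hq T hT).absolutelyContinuousOnInterval_intervalIntegral (c := 0) left_mem_uIcc
  have hφac : AbsolutelyContinuousOnInterval φ 0 T :=
    ContDiffOn.absolutelyContinuousOnInterval ((hφ.of_le (by norm_cast)).contDiffOn)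
  have h1 := hG.integral_mul_deriv_eq_deriv_mul hφac
  have h2 : φ 0 = 0 :=
    apply_eq_zero_of_tsupport_subset hsub fun h => absurd h.1 (not_le.mpr hα)
  have h3 : φ T * 0 = 0 := mul_zero _
  have hφT : (∫ s in (0 : ℝ)..T, q s) * φ T = 0 := by
    have : φ T = 0 := by
      -- `φ` vanishes to the right of `T`, hence at `T`
      have hcl : IsClosed {t | φ t = 0} := isClosed_eq hφ.continuous continuous_const
      have : T ∈ closure (Ioi T) := by simp
      exact hcl.closure_subset_iff.mpr (fun t ht => hφ0 t ht) this
    rw [this, mul_zero]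
  simp only [hφT, h2, mul_zero, sub_zero, zero_sub] at h1
  have h4 : ∫ t in (0 : ℝ)..T, deriv φ t * ∫ s in (0 : ℝ)..t, q s =
      ∫ t in (0 : ℝ)..T, (∫ s in (0 : ℝ)..t, q s) * deriv φ t :=
    intervalIntegral.integral_congr fun t _ => mul_comm _ _
  rw [h4, h1]
  congr 1
  refine intervalIntegral.integral_congr_ae ?_
  filter_upwards [(hq T hT).ae_hasDerivAt_integral] with t ht htm
  rw [(ht (uIoc_subset_uIcc htm) 0 left_mem_uIcc).deriv, mul_comm]

/-- A test function of the open half-line with vanishing integral is the derivative of a test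
function. -/
theorem exists_primitive_test {χ : ℝ → ℝ} (hχ : ContDiff ℝ ∞ χ)
    (hc : HasCompactSupport χ) (hs : tsupport χ ⊆ Ioi 0) (h0 : ∫ t in Ioi (0 : ℝ), χ t = 0) :
    ∃ φ : ℝ → ℝ, ContDiff ℝ ∞ φ ∧ HasCompactSupport φ ∧ tsupport φ ⊆ Ioi 0 ∧ deriv φ = χ := by
  obtain ⟨α, T, hα, hαT, hsub⟩ := exists_tsupport_subset_Icc hc hs
  have hT : 0 ≤ T := hα.le.trans hαT
  have hder : ∀ t, HasDerivAt (fun t => ∫ s in (0 : ℝ)..t, χ s) (χ t) t := fun t =>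
    intervalIntegral.integral_hasDerivAt_right (hχ.continuous.intervalIntegrable _ _)
      (hχ.continuous.stronglyMeasurableAtFilter _ _) hχ.continuous.continuousAt
  have hd : deriv (fun t => ∫ s in (0 : ℝ)..t, χ s) = χ := funext fun t => (hder t).deriv
  have hz : ∀ t, t ∉ Icc α T → ∫ s in (0 : ℝ)..t, χ s = 0 := by
    intro t ht
    rcases lt_or_ge t α with h | h
    · have : ∀ s ∈ uIcc 0 t, χ s = 0 := by
        intro s hs'
        refine apply_eq_zero_of_tsupport_subset hsub fun hh => ?_
        have := hs'.2
        have h5 := hh.1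
        rw [le_sup_iff] at this
        rcases this with h6 | h6 <;> linarith
      rw [intervalIntegral.integral_congr this]; simp
    · have hTt : T < t := by
        by_contra hcon
        exact ht ⟨h, not_lt.mp hcon⟩
      refine (setIntegral_Ioi_eq_intervalIntegral (hT.trans hTt.le) fun s hs' => ?_).symm.trans h0
      exact apply_eq_zero_of_tsupport_subset hsub fun hh => by linarith [hh.2]
  have hts : tsupport (fun t => ∫ s in (0 : ℝ)..t, χ s) ⊆ Icc α T := by
    refine closure_minimal (fun t ht => ?_) isClosed_Icc
    by_contra hcon
    exact ht (hz t hcon)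
  refine ⟨fun t => ∫ s in (0 : ℝ)..t, χ s, ?_, ?_, hts.trans fun t ht => hα.trans_le ht.1, hd⟩
  · rw [contDiff_infty_iff_deriv]
    exact ⟨fun t => (hder t).differentiableAt, by rw [hd]; exact hχ⟩
  · exact isCompact_Icc.of_isClosed_subset (isClosed_tsupport _) hts

/-- The lemma of du Bois-Reymond on the half-line: a function with distributional derivative `q`
is, up to a constant, a primitive of `q`. -/
theorem exists_eq_const_add_integral_of_distribDeriv {p q : ℝ → ℝ}
    (hp : LocallyIntegrableOn p (Ioi 0)) (hq : ∀ T, 0 ≤ T → IntervalIntegrable q volume 0 T)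
    (h : ∀ φ : ℝ → ℝ, ContDiff ℝ ∞ φ → HasCompactSupport φ → tsupport φ ⊆ Ioi 0 →
      ∫ t in Ioi (0 : ℝ), deriv φ t * p t = -∫ t in Ioi (0 : ℝ), φ t * q t) :
    ∃ C : ℝ, ∀ᵐ t, t ∈ Ioi (0 : ℝ) → p t = C + ∫ s in (0 : ℝ)..t, q s := by
  set G : ℝ → ℝ := fun t => ∫ s in (0 : ℝ)..t, q s with hG
  have hGc : ContinuousOn G (Ioi 0) := by
    intro t ht
    have h1 : ContinuousOn G (uIcc 0 (t + 1)) :=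
      intervalIntegral.continuousOn_primitive_interval'
        (hq (t + 1) (by have : 0 < t := ht; linarith)) left_mem_uIcc
    have ht0 : 0 < t := ht
    refine (h1.continuousAt ?_).continuousWithinAt
    rw [uIcc_of_le (by linarith)]
    exact Icc_mem_nhds ht0 (by linarith)
  have hGl : LocallyIntegrableOn G (Ioi 0) := hGc.locallyIntegrableOn measurableSet_Ioi
  have hl : LocallyIntegrableOn (fun t => p t - G t) (Ioi 0) := hp.sub hGl
  -- test functions are integrable against locally integrable functions
  have hint : ∀ {k φ : ℝ → ℝ}, LocallyIntegrableOn k (Ioi 0) → Continuous φ →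
      HasCompactSupport φ → tsupport φ ⊆ Ioi 0 → IntegrableOn (fun t => φ t * k t) (Ioi 0) := by
    intro k φ hk hφ hc hs
    obtain ⟨α, T, hα, hαT, hsub⟩ := exists_tsupport_subset_Icc hc hs
    have h1 : IntegrableOn k (Icc α T) :=
      hk.integrableOn_compact_subset (fun t ht => hα.trans_le ht.1) isCompact_Icc
    have h2 : IntegrableOn (fun t => φ t * k t) (Icc α T) :=
      h1.continuousOn_mul hφ.continuousOn isCompact_Icc
    refine (integrableOn_iff_integrable_of_support_subset ?_).mp h2 |>.integrableOn
    intro t ht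
    by_contra hcon
    exact ht (by simp only [apply_eq_zero_of_tsupport_subset hsub hcon, zero_mul])
  have hzero : ∀ φ : ℝ → ℝ, ContDiff ℝ ∞ φ → HasCompactSupport φ → tsupport φ ⊆ Ioi 0 →
      ∫ t in Ioi (0 : ℝ), deriv φ t * (p t - G t) = 0 := by
    intro φ hφ hc hs
    have hd : Continuous (deriv φ) := (hφ.continuous_deriv (by norm_cast))
    have hdc : HasCompactSupport (deriv φ) := hc.deriv
    have hds : tsupport (deriv φ) ⊆ Ioi 0 := tsupport_deriv_subset.trans hs
    simp only [mul_sub]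
    rw [integral_sub (hint hp hd hdc hds) (hint hGl hd hdc hds), h φ hφ hc hs,
      integral_deriv_mul_primitive hq hφ hc hs, sub_self]
  -- a fixed test function `ρ` with integral one
  obtain ⟨ρ, hρ, hρc, hρs, hρ1⟩ : ∃ ρ : ℝ → ℝ, ContDiff ℝ ∞ ρ ∧ HasCompactSupport ρ ∧
      tsupport ρ ⊆ Ioi 0 ∧ ∫ t in Ioi (0 : ℝ), ρ t = 1 := by
    let B : ContDiffBump (1 : ℝ) := ⟨1 / 4, 1 / 2, by norm_num, by norm_num⟩
    have hsupp : tsupport (B.normed volume) ⊆ Ioi 0 := by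
      rw [B.tsupport_normed_eq]
      intro t ht
      rw [Real.closedBall_eq_Icc] at ht
      have : (1 : ℝ) - 1 / 2 ≤ t := ht.1
      change 0 < t
      linarith
    refine ⟨B.normed volume, B.contDiff_normed, B.hasCompactSupport_normed, hsupp, ?_⟩
    rw [setIntegral_eq_integral_of_forall_compl_eq_zero, B.integral_normed]
    exact fun t ht => apply_eq_zero_of_tsupport_subset hsupp ht
  set K := ∫ t in Ioi (0 : ℝ), ρ t * (p t - G t) with hK
  have hconst : LocallyIntegrableOn (fun _ : ℝ => (1 : ℝ)) (Ioi 0) :=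
    continuousOn_const.locallyIntegrableOn measurableSet_Ioi
  refine ⟨K, ?_⟩
  have hlK : LocallyIntegrableOn (fun t => p t - G t - K) (Ioi 0) :=
    hl.sub (continuousOn_const.locallyIntegrableOn measurableSet_Ioi)
  have hfin := isOpen_Ioi.ae_eq_zero_of_integral_contDiff_smul_eq_zero hlK fun ψ hψ hψc hψs => ?_
  · filter_upwards [hfin] with t ht htm
    linarith [ht htm]
  · have hψi : IntegrableOn ψ (Ioi 0) := by
      simpa using hint hconst hψ.continuous hψc hψs
    have hρi : IntegrableOn ρ (Ioi 0) := by
      simpa using hint hconst hρ.continuous hρc hρs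
    set m := ∫ t in Ioi (0 : ℝ), ψ t with hm
    have hsub : tsupport (fun t => ψ t - m * ρ t) ⊆ tsupport ψ ∪ tsupport ρ := by
      refine closure_minimal (fun t ht => ?_)
        ((isClosed_tsupport ψ).union (isClosed_tsupport ρ))
      by_contra hcon
      simp only [mem_union, not_or] at hcon
      refine ht ?_
      simp only [image_eq_zero_of_notMem_tsupport hcon.1, image_eq_zero_of_notMem_tsupport hcon.2,
        mul_zero, sub_zero]
    obtain ⟨φ, hφ, hφc, hφs, hφd⟩ := exists_primitive_test (χ := fun t => ψ t - m * ρ t)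
      (hψ.sub (contDiff_const.mul hρ))
      ((hψc.isCompact.union hρc.isCompact).of_isClosed_subset (isClosed_tsupport _) hsub)
      (hsub.trans (union_subset hψs hρs))
      (by rw [integral_sub hψi (hρi.const_mul m), integral_const_mul, hρ1]; simp [hm])
    have h1 := hzero φ hφ hφc hφs
    rw [hφd] at h1
    have h2 : ∫ t in Ioi (0 : ℝ), (ψ t - m * ρ t) * (p t - G t) =
        (∫ t in Ioi (0 : ℝ), ψ t * (p t - G t)) - m * K := by
      rw [hK, ← integral_const_mul, ← integral_sub (hint hl hψ.continuous hψc hψs)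
        ((hint hl hρ.continuous hρc hρs).const_mul m)]
      exact integral_congr_ae (Filter.Eventually.of_forall fun t => by ring)
    have h3 : ∫ t in Ioi (0 : ℝ), ψ t • (p t - G t - K) =
        (∫ t in Ioi (0 : ℝ), ψ t * (p t - G t)) - m * K := by
      rw [hm, ← integral_mul_const, ← integral_sub (hint hl hψ.continuous hψc hψs)
        (hψi.mul_const K)]
      exact integral_congr_ae (Filter.Eventually.of_forall fun t => by
        simp only [smul_eq_mul]; ring)
    have h4 : ∫ t in Ioi (0 : ℝ), ψ t • (p t - G t - K) = 0 := by rw [h3, ← h2, h1]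
    rw [setIntegral_eq_integral_of_forall_compl_eq_zero] at h4
    · exact h4
    · intro t ht
      rw [apply_eq_zero_of_tsupport_subset hψs ht, zero_smul]

/-! ### The Lyapunov functional of finitely many modes -/

section Modal

variable {ι : Type*}

/-- The energy of the modes in `S`, in terms of the coordinates `u`, `v`, `θ` in an eigenbasis and
of the square roots `κ` of the eigenvalues. -/
noncomputable def modalEnergy (S : Finset ι) (κ : ι → ℝ) (β : ℝ) (u v θ : ι → ℝ) : ℝ :=
  1 / 2 * (∑ i ∈ S, (κ i * u i) ^ 2 + ∑ i ∈ S, v i ^ 2 + ∑ i ∈ S, θ i ^ 2)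
    + 1 / 4 * (β + ∑ i ∈ S, κ i * u i ^ 2) ^ 2

/-- The Lyapunov functional of the modes in `S`: the energy, corrected by the work `⟨F, u⟩` of the
force and by small multiples of `⟨u, v⟩` and `⟨v, A^{-1/2} θ⟩`, which produce dissipation of `u` and
of `v` respectively. -/
noncomputable def modalLyapunov (S : Finset ι) (κ : ι → ℝ) (β ε : ℝ) (u v θ F : ι → ℝ) : ℝ :=
  modalEnergy S κ β u v θ
    + ∑ i ∈ S, (-(F i * u i) + ε * (u i * v i + 2 * ((κ i)⁻¹ * (v i * θ i))))

theorem hasDerivAt_modalLyapunov (S : Finset ι) (κ : ι → ℝ) (β ε : ℝ) {u v θ F : ι → ℝ → ℝ}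
    {v' θ' F' : ι → ℝ} {t : ℝ} (hu : ∀ i ∈ S, HasDerivAt (u i) (v i t) t)
    (hv : ∀ i ∈ S, HasDerivAt (v i) (v' i) t) (hθ : ∀ i ∈ S, HasDerivAt (θ i) (θ' i) t)
    (hF : ∀ i ∈ S, HasDerivAt (F i) (F' i) t) :
    HasDerivAt (fun t => modalLyapunov S κ β ε (u · t) (v · t) (θ · t) (F · t))
      ((∑ i ∈ S, (κ i ^ 2 * u i t * v i t + v i t * v' i + θ i t * θ' i)
        + (β + ∑ i ∈ S, κ i * u i t ^ 2) * ∑ i ∈ S, κ i * u i t * v i t)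
        + ∑ i ∈ S, (-(F' i * u i t + F i t * v i t) + ε * (v i t * v i t + u i t * v' i
          + 2 * ((κ i)⁻¹ * (v' i * θ i t + v i t * θ' i))))) t := by
  unfold modalLyapunov modalEnergy
  have h1 : HasDerivAt (fun t => ∑ i ∈ S, (κ i * u i t) ^ 2)
      (∑ i ∈ S, 2 * (κ i ^ 2 * u i t * v i t)) t :=
    HasDerivAt.fun_sum fun i hi =>
      (((hu i hi).const_mul (κ i)).fun_pow 2).congr_deriv (by ring)
  have h2 : HasDerivAt (fun t => ∑ i ∈ S, v i t ^ 2) (∑ i ∈ S, 2 * (v i t * v' i)) t :=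
    HasDerivAt.fun_sum fun i hi => ((hv i hi).fun_pow 2).congr_deriv (by ring)
  have h3 : HasDerivAt (fun t => ∑ i ∈ S, θ i t ^ 2) (∑ i ∈ S, 2 * (θ i t * θ' i)) t :=
    HasDerivAt.fun_sum fun i hi => ((hθ i hi).fun_pow 2).congr_deriv (by ring)
  have h4 : HasDerivAt (fun t => ∑ i ∈ S, κ i * u i t ^ 2)
      (∑ i ∈ S, 2 * (κ i * u i t * v i t)) t :=
    HasDerivAt.fun_sum fun i hi =>
      (((hu i hi).fun_pow 2).const_mul (κ i)).congr_deriv (by ring)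
  refine HasDerivAt.add ?_ ?_
  · refine ((((h1.add h2).add h3).const_mul (1 / 2)).add
      (((h4.const_add β).fun_pow 2).const_mul (1 / 4))).congr_deriv ?_
    simp only [← Finset.mul_sum, Finset.sum_add_distrib]
    ring
  · refine HasDerivAt.fun_sum fun i hi => ?_
    refine (((hF i hi).mul (hu i hi)).neg.add ((((hu i hi).mul (hv i hi)).add
      ((((hv i hi).mul (hθ i hi)).const_mul (κ i)⁻¹).const_mul 2)).const_mul ε)).congr_deriv ?_
    ring

theorem AbsolutelyContinuousOnInterval.fun_sum {f : ι → ℝ → ℝ} {a b : ℝ} (S : Finset ι)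
    (h : ∀ i ∈ S, AbsolutelyContinuousOnInterval (f i) a b) :
    AbsolutelyContinuousOnInterval (fun t => ∑ i ∈ S, f i t) a b := by
  classical
  induction S using Finset.induction_on with
  | empty =>
    simp only [Finset.sum_empty]
    exact (contDiff_const.contDiffOn).absolutelyContinuousOnInterval
  | insert i S hi ih =>
    simp only [Finset.sum_insert hi]
    exact (h i (Finset.mem_insert_self i S)).fun_add
      (ih fun j hj => h j (Finset.mem_insert_of_mem hj))

theorem absolutelyContinuousOnInterval_modalLyapunov (S : Finset ι) (κ : ι → ℝ) (β ε : ℝ)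
    {u v θ F : ι → ℝ → ℝ} {a b : ℝ}
    (hu : ∀ i ∈ S, AbsolutelyContinuousOnInterval (u i) a b)
    (hv : ∀ i ∈ S, AbsolutelyContinuousOnInterval (v i) a b)
    (hθ : ∀ i ∈ S, AbsolutelyContinuousOnInterval (θ i) a b)
    (hF : ∀ i ∈ S, AbsolutelyContinuousOnInterval (F i) a b) :
    AbsolutelyContinuousOnInterval
      (fun t => modalLyapunov S κ β ε (u · t) (v · t) (θ · t) (F · t)) a b := by
  have hconst : ∀ x : ℝ, AbsolutelyContinuousOnInterval (fun _ : ℝ => x) a b := fun x =>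
    (contDiff_const.contDiffOn).absolutelyContinuousOnInterval
  have hsq : ∀ {f : ℝ → ℝ}, AbsolutelyContinuousOnInterval f a b →
      AbsolutelyContinuousOnInterval (fun t => f t ^ 2) a b := by
    intro f hf
    simpa only [sq] using hf.fun_mul hf
  unfold modalLyapunov modalEnergy
  refine .fun_add (.fun_add (.const_mul _ (.fun_add (.fun_add ?_ ?_) ?_))
    (.const_mul _ (hsq (.fun_add (hconst β) ?_)))) ?_
  · exact .fun_sum S fun i hi => hsq ((hu i hi).const_mul _)
  · exact .fun_sum S fun i hi => hsq (hv i hi)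
  · exact .fun_sum S fun i hi => hsq (hθ i hi)
  · exact .fun_sum S fun i hi => (hsq (hu i hi)).const_mul _
  · exact .fun_sum S fun i hi => .fun_add ((hF i hi).fun_mul (hu i hi)).fun_neg
      (.const_mul _ (.fun_add ((hu i hi).fun_mul (hv i hi))
        (.const_mul _ (.const_mul _ ((hv i hi).fun_mul (hθ i hi))))))

/-- The dissipation inequality in terms of the sums that occur in it. The dissipated quantity `T₁`
pays for all terms in `θ`; the cubic term `(β + s) Y` costs `ε² k⁶`. -/
theorem rate_le_aux {M β ε k s σ g p U V Θ T₁ P Q W Y FU FT GT PU GV FF : ℝ}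
    (hM : 2 ≤ M) (hβ : |β| ≤ M) (hε : 0 ≤ ε) (hεM : 24 * M * ε ≤ 1) (hk : 0 ≤ k)
    (hp : 0 ≤ p)
    (hσ0 : 0 ≤ σ) (hσs : σ ≤ s) (hs : s ≤ 5 * k ^ 2) (hβs : |β + s| ≤ 4 * k ^ 2)
    (hUV : U + V ≤ 8 * k ^ 4) (hV0 : 0 ≤ V) (hΘ0 : 0 ≤ Θ) (hT0 : 0 ≤ T₁)
    (hΘ : Θ ≤ M * T₁) (hP : |P| ≤ 1 / 2 * (U + V)) (hQ : |Q| ≤ 1 / 2 * (U + Θ))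
    (hW : |W| ≤ 1 / 4 * V + Θ) (hY : Y ^ 2 ≤ M ^ 2 * (σ * T₁))
    (hFF : FF ≤ M ^ 2) (hFU : FU ≤ 2 * M ^ 2 * FF + 1 / 8 * U)
    (hFT : 2 * FT ≤ M ^ 2 * FF + Θ) (hGT : |GT| ≤ g * √T₁) (hPU : |PU| ≤ p * √σ)
    (hGV : |GV| ≤ g * √(M * V)) :
    -T₁ + GT - PU + (σ - s) * P
      + ε * (V - U + Q - (β + s) * σ + FU)
      + 2 * ε * (-Q + Θ - (β + s) * Y + FT - W - V + GV)
    ≤ -(3 / 4) * ε * (1 / 2 * (U + V + Θ) + 1 / 4 * (β + σ) ^ 2)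
      + 4 * k ^ 4 * (s - σ) + g ^ 2 + 3 * k * p + ε * (4 * M ^ 4 + 8 * M * g ^ 2)
      + 320 * ε ^ 2 * k ^ 6 * M ^ 2 := by
  have e1 : GT ≤ 1 / 4 * T₁ + g ^ 2 := by
    have h := Real.sq_sqrt hT0
    nlinarith [le_abs_self GT, sq_nonneg (1 / 2 * √T₁ - g)]
  have e2 : -PU ≤ 3 * k * p := by
    have h : √σ ≤ 3 * k := Real.sqrt_le_iff.mpr ⟨by positivity, by nlinarith [sq_nonneg k]⟩
    have := mul_le_mul_of_nonneg_left h hp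
    linarith [neg_abs_le PU]
  have e3 : (σ - s) * P ≤ 4 * k ^ 4 * (s - σ) := by
    have h1 : -P ≤ 4 * k ^ 4 := by linarith [neg_abs_le P]
    linarith [mul_le_mul_of_nonneg_left h1 (sub_nonneg.mpr hσs)]
  have e4 : -2 * ε * (β + s) * Y ≤ 1 / 4 * T₁ + 320 * ε ^ 2 * k ^ 6 * M ^ 2 := by
    have h1 : Y ^ 2 ≤ M ^ 2 * (5 * k ^ 2 * T₁) :=
      hY.trans (by gcongr; exact hσs.trans hs)
    have h2 : (2 * ε * (β + s) * Y) ^ 2 ≤ (8 * ε * k ^ 2) ^ 2 * (M ^ 2 * (5 * k ^ 2 * T₁)) := by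
      have h3 : (β + s) ^ 2 ≤ (4 * k ^ 2) ^ 2 := sq_le_sq' (by linarith [neg_abs_le (β + s)])
        ((le_abs_self _).trans hβs)
      calc (2 * ε * (β + s) * Y) ^ 2 = (2 * ε) ^ 2 * (β + s) ^ 2 * Y ^ 2 := by ring
        _ ≤ (2 * ε) ^ 2 * (4 * k ^ 2) ^ 2 * (M ^ 2 * (5 * k ^ 2 * T₁)) := by gcongr
        _ = _ := by ring
    set D := 320 * ε ^ 2 * k ^ 6 * M ^ 2 with hD
    have hD0 : 0 ≤ D := by positivity
    have h4 : (2 * ε * (β + s) * Y) ^ 2 ≤ (1 / 4 * T₁ + D) ^ 2 := by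
      have : (8 * ε * k ^ 2) ^ 2 * (M ^ 2 * (5 * k ^ 2 * T₁)) = D * T₁ := by rw [hD]; ring
      linarith [sq_nonneg (1 / 4 * T₁ - D)]
    have h5 := (abs_le_of_sq_le_sq' h4 (by positivity)).1
    linarith
  have e5 : 2 * GV ≤ 1 / 8 * V + 8 * M * g ^ 2 := by
    have hMV : 0 ≤ M * V := mul_nonneg (by linarith) hV0
    have h := Real.sq_sqrt hMV
    have h1 : (2 * (g * √(M * V))) ^ 2 ≤ (1 / 8 * V + 8 * M * g ^ 2) ^ 2 := by
      have : (2 * (g * √(M * V))) ^ 2 = 4 * (g ^ 2 * (M * V)) := by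
        rw [mul_pow, mul_pow, h]; ring
      rw [this]
      linarith [sq_nonneg (1 / 8 * V - 8 * M * g ^ 2)]
    have h2 := (abs_le_of_sq_le_sq' h1 (by positivity)).2
    linarith [le_abs_self GV]
  have e6 : -(β + s) * σ ≤ -(1 / 2) * (β + σ) ^ 2 + 1 / 2 * M ^ 2 := by
    have h1 : β ^ 2 ≤ M ^ 2 := sq_le_sq' (by linarith [neg_abs_le β]) ((le_abs_self _).trans hβ)
    linarith [mul_nonneg (sub_nonneg.mpr hσs) hσ0, sq_nonneg σ]
  have e7 : 6 * ε * Θ ≤ 1 / 4 * T₁ := by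
    have h1 : 6 * ε * Θ ≤ 6 * ε * (M * T₁) := by gcongr
    linarith [mul_le_mul_of_nonneg_right hεM hT0]
  have e8 : V - U + Q - (β + s) * σ + FU + 2 * (-Q + Θ + FT - W - V + GV)
      ≤ -(3 / 4) * (1 / 2 * (U + V + Θ) + 1 / 4 * (β + σ) ^ 2) + 6 * Θ
        + (4 * M ^ 4 + 8 * M * g ^ 2) := by
    have h1 : 3 * M ^ 2 * FF + 1 / 2 * M ^ 2 ≤ 4 * M ^ 4 := by
      have : 3 * M ^ 2 * FF ≤ 3 * M ^ 2 * M ^ 2 := by gcongr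
      have h2 : M ^ 2 ≤ M ^ 4 := pow_le_pow_right₀ (by linarith) (by norm_num)
      have h3 : 0 ≤ M ^ 4 := by positivity
      linarith
    linarith [neg_abs_le Q, neg_abs_le W, sq_nonneg (β + σ)]
  linarith [mul_le_mul_of_nonneg_left e8 hε]

/-- The dissipation inequality for the Lyapunov functional of finitely many modes. The left-hand
side is the derivative from `hasDerivAt_modalLyapunov`, with `v'`, `θ'` replaced by means of the
equations; `s` is the full norm `‖u‖₁²`, of which only the part `∑ i ∈ S, κ i * u i ^ 2` is carried
by the modes in `S`. -/
theorem modal_rate_le (S : Finset ι) {κ : ι → ℝ} {M β ε k s g p : ℝ} {u v θ F γ φ v' θ' : ι → ℝ}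
    (hM : 2 ≤ M) (hβ : |β| ≤ M) (hε : 0 ≤ ε) (hεM : 24 * M * ε ≤ 1) (hk : 0 ≤ k)
    (hp : 0 ≤ p) (hκ : ∀ i, 0 < κ i) (hκM : ∀ i, 1 ≤ M * κ i)
    (hσs : ∑ i ∈ S, κ i * u i ^ 2 ≤ s) (hs : s ≤ 5 * k ^ 2) (hβs : |β + s| ≤ 4 * k ^ 2)
    (hUV : ∑ i ∈ S, (κ i * u i) ^ 2 + ∑ i ∈ S, v i ^ 2 ≤ 8 * k ^ 4)
    (hFF : ∑ i ∈ S, F i ^ 2 ≤ M ^ 2)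
    (hv' : ∀ i, v' i = -(κ i ^ 2 * u i) + κ i * θ i - (β + s) * (κ i * u i) + F i)
    (hθ' : ∀ i, θ' i = -(κ i * θ i) - κ i * v i + γ i)
    (hγ : ∀ a : ι → ℝ, |∑ i ∈ S, a i * γ i| ≤ g * √(∑ i ∈ S, κ i * a i ^ 2))
    (hg : 0 ≤ g)
    (hφ : |∑ i ∈ S, u i * φ i| ≤ p * √(∑ i ∈ S, κ i * u i ^ 2)) :
    (∑ i ∈ S, (κ i ^ 2 * u i * v i + v i * v' i + θ i * θ' i)
        + (β + ∑ i ∈ S, κ i * u i ^ 2) * ∑ i ∈ S, κ i * u i * v i)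
        + ∑ i ∈ S, (-(φ i * u i + F i * v i) + ε * (v i * v i + u i * v' i
          + 2 * ((κ i)⁻¹ * (v' i * θ i + v i * θ' i))))
      ≤ -(3 / 4) * ε * modalEnergy S κ β u v θ
        + 4 * k ^ 4 * (s - ∑ i ∈ S, κ i * u i ^ 2) + g ^ 2 + 3 * k * p
        + ε * (4 * M ^ 4 + 8 * M * g ^ 2) + 320 * ε ^ 2 * k ^ 6 * M ^ 2 := by
  have hM0 : 0 ≤ M := by linarith
  have hκM2 : ∀ i, 1 ≤ M ^ 2 * κ i ^ 2 := fun i => by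
    rw [← mul_pow]; exact one_le_pow₀ (hκM i)
  have key := rate_le_aux (M := M) (β := β) (ε := ε) (k := k) (s := s) (g := g) (p := p)
    (σ := ∑ i ∈ S, κ i * u i ^ 2) (U := ∑ i ∈ S, (κ i * u i) ^ 2) (V := ∑ i ∈ S, v i ^ 2)
    (Θ := ∑ i ∈ S, θ i ^ 2) (T₁ := ∑ i ∈ S, κ i * θ i ^ 2) (P := ∑ i ∈ S, κ i * u i * v i)
    (Q := ∑ i ∈ S, κ i * u i * θ i) (W := ∑ i ∈ S, v i * θ i) (Y := ∑ i ∈ S, u i * θ i)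
    (FU := ∑ i ∈ S, F i * u i) (FT := ∑ i ∈ S, (κ i)⁻¹ * (F i * θ i))
    (GT := ∑ i ∈ S, θ i * γ i) (PU := ∑ i ∈ S, u i * φ i)
    (GV := ∑ i ∈ S, (κ i)⁻¹ * v i * γ i) (FF := ∑ i ∈ S, F i ^ 2)
    hM hβ hε hεM hk hp (Finset.sum_nonneg fun i _ => by have := hκ i; positivity) hσs hs hβs hUV
    (Finset.sum_nonneg fun i _ => sq_nonneg _) (Finset.sum_nonneg fun i _ => sq_nonneg _)
    (Finset.sum_nonneg fun i _ => by have := hκ i; positivity)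
    ?_ ?_ ?_ ?_ ?_ hFF ?_ ?_ (hγ θ) hφ ?_
  · refine le_of_eq_of_le ?_ (key.trans_eq ?_)
    · simp only [Finset.mul_sum, ← Finset.sum_neg_distrib, ← Finset.sum_add_distrib,
        ← Finset.sum_sub_distrib, add_mul, sub_mul, mul_add, mul_sub]
      refine Finset.sum_congr rfl fun i _ => ?_
      have hne := (hκ i).ne'
      rw [hv' i, hθ' i]
      field_simp
      ring
    · rw [modalEnergy]
  · rw [Finset.mul_sum]
    refine Finset.sum_le_sum fun i _ => ?_
    have := mul_le_mul_of_nonneg_right (hκM i) (sq_nonneg (θ i))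
    linarith
  · rw [← Finset.sum_add_distrib, Finset.mul_sum]
    refine (Finset.abs_sum_le_sum_abs _ _).trans (Finset.sum_le_sum fun i _ => ?_)
    rw [abs_le]
    constructor <;> nlinarith [sq_nonneg (κ i * u i + v i), sq_nonneg (κ i * u i - v i)]
  · rw [← Finset.sum_add_distrib, Finset.mul_sum]
    refine (Finset.abs_sum_le_sum_abs _ _).trans (Finset.sum_le_sum fun i _ => ?_)
    rw [abs_le]
    constructor <;> nlinarith [sq_nonneg (κ i * u i + θ i), sq_nonneg (κ i * u i - θ i)]
  · rw [Finset.mul_sum, ← Finset.sum_add_distrib]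
    refine (Finset.abs_sum_le_sum_abs _ _).trans (Finset.sum_le_sum fun i _ => ?_)
    rw [abs_le]
    constructor <;> nlinarith [sq_nonneg (1 / 2 * v i + θ i), sq_nonneg (1 / 2 * v i - θ i)]
  · have h1 := Finset.sum_mul_sq_le_sq_mul_sq S u θ
    have h2 : ∀ x : ι → ℝ, ∑ i ∈ S, x i ^ 2 ≤ M * ∑ i ∈ S, κ i * x i ^ 2 := by
      intro x
      rw [Finset.mul_sum]
      refine Finset.sum_le_sum fun i _ => ?_
      have := mul_le_mul_of_nonneg_right (hκM i) (sq_nonneg (x i))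
      linarith
    have h3 : ∀ x : ι → ℝ, 0 ≤ ∑ i ∈ S, x i ^ 2 := fun x => Finset.sum_nonneg fun i _ => sq_nonneg _
    calc (∑ i ∈ S, u i * θ i) ^ 2 ≤ (∑ i ∈ S, u i ^ 2) * ∑ i ∈ S, θ i ^ 2 := h1
      _ ≤ (M * ∑ i ∈ S, κ i * u i ^ 2) * (M * ∑ i ∈ S, κ i * θ i ^ 2) :=
        mul_le_mul (h2 u) (h2 θ) (h3 θ) ((h3 u).trans (h2 u))
      _ = _ := by ring
  · rw [Finset.mul_sum, Finset.mul_sum, ← Finset.sum_add_distrib]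
    refine Finset.sum_le_sum fun i _ => ?_
    have h1 := mul_le_mul_of_nonneg_right (hκM2 i) (sq_nonneg (u i))
    have h2 : F i * u i ≤ 2 * M ^ 2 * F i ^ 2 + 1 / 8 * (κ i * u i) ^ 2 := by
      have h3 : (M * κ i) * (M * κ i) ≥ 1 := by nlinarith [hκM i]
      have h4 : F i * u i ≤ (M * κ i) * |F i * u i| :=
        (le_abs_self _).trans (le_mul_of_one_le_left (abs_nonneg _) (hκM i))
      rcases abs_cases (F i * u i) with ⟨e, -⟩ | ⟨e, -⟩ <;> rw [e] at h4 <;>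
        nlinarith [sq_nonneg (4 * M * F i - κ i * u i), sq_nonneg (4 * M * F i + κ i * u i)]
    exact h2
  · rw [Finset.mul_sum, Finset.mul_sum, ← Finset.sum_add_distrib]
    refine Finset.sum_le_sum fun i _ => ?_
    have h1 : (κ i)⁻¹ ≤ M := by
      rw [inv_le_iff_one_le_mul₀ (hκ i)]; exact hκM i
    have h2 : 0 ≤ (κ i)⁻¹ := (inv_pos.mpr (hκ i)).le
    have h3 : (κ i)⁻¹ ^ 2 * F i ^ 2 ≤ M ^ 2 * F i ^ 2 := by gcongr
    nlinarith [sq_nonneg ((κ i)⁻¹ * F i - θ i)]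
  · refine (hγ fun i => (κ i)⁻¹ * v i).trans ?_
    refine mul_le_mul_of_nonneg_left (Real.sqrt_le_sqrt ?_) hg
    rw [Finset.mul_sum]
    refine Finset.sum_le_sum fun i _ => ?_
    have h1 : (κ i)⁻¹ ≤ M := by
      rw [inv_le_iff_one_le_mul₀ (hκ i)]; exact hκM i
    calc κ i * ((κ i)⁻¹ * v i) ^ 2 = (κ i)⁻¹ * v i ^ 2 := by
          have := (hκ i).ne'; field_simp
      _ ≤ M * v i ^ 2 := by gcongr

/-- The Lyapunov functional differs little from the energy. -/
theorem abs_modalLyapunov_sub_le (S : Finset ι) {κ : ι → ℝ} {M β ε k : ℝ} {u v θ F : ι → ℝ}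
    (hM : 2 ≤ M) (hε : 0 ≤ ε) (hεM : 8 * M ^ 2 * ε * k ^ 2 ≤ 1) (hk : M ≤ k)
    (hκ : ∀ i, 0 < κ i) (hκM : ∀ i, 1 ≤ M * κ i)
    (hs : ∑ i ∈ S, κ i * u i ^ 2 ≤ 5 * k ^ 2)
    (hE : ∑ i ∈ S, (κ i * u i) ^ 2 + ∑ i ∈ S, v i ^ 2 + ∑ i ∈ S, θ i ^ 2 ≤ 8 * k ^ 4)
    (hFF : ∑ i ∈ S, F i ^ 2 ≤ M ^ 2) :
    |modalLyapunov S κ β ε u v θ F - modalEnergy S κ β u v θ| ≤ 4 * M * k ^ 2 := by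
  have hM0 : 0 ≤ M := by linarith
  rw [modalLyapunov, add_sub_cancel_left]
  have h1 : |∑ i ∈ S, (-(F i * u i) + ε * (u i * v i + 2 * ((κ i)⁻¹ * (v i * θ i))))|
      ≤ ∑ i ∈ S, (1 / 2 * F i ^ 2 + 1 / 2 * (M * (κ i * u i ^ 2))
        + ε * (M ^ 2 * ((κ i * u i) ^ 2 + v i ^ 2 + θ i ^ 2))) := by
    refine (Finset.abs_sum_le_sum_abs _ _).trans (Finset.sum_le_sum fun i _ => ?_)
    have a1 : |F i * u i| ≤ 1 / 2 * F i ^ 2 + 1 / 2 * (M * (κ i * u i ^ 2)) := by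
      have := mul_le_mul_of_nonneg_right (hκM i) (sq_nonneg (u i))
      rw [abs_le]
      constructor <;> nlinarith [sq_nonneg (F i + u i), sq_nonneg (F i - u i)]
    have a2 : |u i * v i| ≤ 1 / 2 * (M ^ 2 * (κ i * u i) ^ 2) + 1 / 2 * v i ^ 2 := by
      have h2 : u i ^ 2 ≤ M ^ 2 * (κ i * u i) ^ 2 := by
        have : 1 ≤ (M * κ i) ^ 2 := one_le_pow₀ (hκM i)
        have := mul_le_mul_of_nonneg_right this (sq_nonneg (u i))
        linarith
      rw [abs_le]
      constructor <;> nlinarith [sq_nonneg (u i + v i), sq_nonneg (u i - v i)]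
    have a3 : |2 * ((κ i)⁻¹ * (v i * θ i))| ≤ M * (v i ^ 2 + θ i ^ 2) := by
      have b1 : (κ i)⁻¹ ≤ M := by
        rw [inv_le_iff_one_le_mul₀ (hκ i)]; exact hκM i
      have b2 : 0 ≤ (κ i)⁻¹ := (inv_pos.mpr (hκ i)).le
      have b3 : 2 * |v i * θ i| ≤ v i ^ 2 + θ i ^ 2 := by
        rcases abs_cases (v i * θ i) with ⟨e, -⟩ | ⟨e, -⟩ <;> rw [e] <;>
          nlinarith [sq_nonneg (v i + θ i), sq_nonneg (v i - θ i)]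
      rw [abs_mul, abs_mul, abs_of_nonneg b2, abs_of_nonneg (zero_le_two (α := ℝ))]
      calc 2 * ((κ i)⁻¹ * |v i * θ i|) = (κ i)⁻¹ * (2 * |v i * θ i|) := by ring
        _ ≤ M * (v i ^ 2 + θ i ^ 2) := mul_le_mul b1 b3 (by positivity) hM0
    have a4 : |u i * v i + 2 * ((κ i)⁻¹ * (v i * θ i))|
        ≤ M ^ 2 * ((κ i * u i) ^ 2 + v i ^ 2 + θ i ^ 2) := by
      refine (abs_add_le _ _).trans ((add_le_add a2 a3).trans ?_)
      have c1 : M + 1 / 2 ≤ M ^ 2 := by nlinarith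
      have c2 : M ≤ M ^ 2 := by nlinarith
      nlinarith [mul_le_mul_of_nonneg_right c1 (sq_nonneg (v i)),
        mul_le_mul_of_nonneg_right c2 (sq_nonneg (θ i)),
        mul_nonneg (sq_nonneg M) (sq_nonneg (κ i * u i))]
    refine (abs_add_le _ _).trans (add_le_add ?_ ?_)
    · rwa [abs_neg]
    · rw [abs_mul, abs_of_nonneg hε]
      exact mul_le_mul_of_nonneg_left a4 hε
  refine h1.trans ?_
  simp only [Finset.sum_add_distrib, ← Finset.mul_sum]
  have h2 : ε * (M ^ 2 * (∑ i ∈ S, (κ i * u i) ^ 2 + ∑ i ∈ S, v i ^ 2 + ∑ i ∈ S, θ i ^ 2))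
      ≤ k ^ 2 := by
    calc _ ≤ ε * (M ^ 2 * (8 * k ^ 4)) := by gcongr
      _ = (8 * M ^ 2 * ε * k ^ 2) * k ^ 2 := by ring
      _ ≤ 1 * k ^ 2 := by gcongr
      _ = k ^ 2 := one_mul _
  have h3 : M * ∑ i ∈ S, κ i * u i ^ 2 ≤ M * (5 * k ^ 2) := by gcongr
  have h4 : M ^ 2 ≤ k ^ 2 := by gcongr
  have h5 : 2 * k ^ 2 ≤ M * k ^ 2 := by gcongr
  linarith [sq_nonneg k]

theorem continuousOn_modalEnergy (S : Finset ι) (κ : ι → ℝ) (β : ℝ) {u v θ : ι → ℝ → ℝ}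
    {s : Set ℝ} (hu : ∀ i, ContinuousOn (u i) s) (hv : ∀ i, ContinuousOn (v i) s)
    (hθ : ∀ i, ContinuousOn (θ i) s) :
    ContinuousOn (fun t => modalEnergy S κ β (u · t) (v · t) (θ · t)) s := by
  unfold modalEnergy
  fun_prop

/-- The integrated dissipation inequality for the modes in `S` on an interval `[a, b]` on which the
energy is at most of order `k⁴`. -/
theorem modalEnergy_le_add_integral [Countable ι] (S : Finset ι) {κ : ι → ℝ} {M β ε k a b : ℝ}
    {u v θ F γ φ v' θ' : ι → ℝ → ℝ} {s g p : ℝ → ℝ} (hab : a ≤ b)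
    (hM : 2 ≤ M) (hβ : |β| ≤ M) (hε : 0 ≤ ε) (hεM : 24 * M * ε ≤ 1)
    (hεk : 8 * M ^ 2 * ε * k ^ 2 ≤ 1) (hk : M ≤ k) (hκ : ∀ i, 0 < κ i) (hκM : ∀ i, 1 ≤ M * κ i)
    (hu : ∀ i, AbsolutelyContinuousOnInterval (u i) a b)
    (hv : ∀ i, AbsolutelyContinuousOnInterval (v i) a b)
    (hθ : ∀ i, AbsolutelyContinuousOnInterval (θ i) a b)
    (hF : ∀ i, AbsolutelyContinuousOnInterval (F i) a b)
    (hdu : ∀ i, ∀ᵐ t, t ∈ Icc a b → HasDerivAt (u i) (v i t) t)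
    (hdv : ∀ i, ∀ᵐ t, t ∈ Icc a b → HasDerivAt (v i) (v' i t) t)
    (hdθ : ∀ i, ∀ᵐ t, t ∈ Icc a b → HasDerivAt (θ i) (θ' i t) t)
    (hdF : ∀ i, ∀ᵐ t, t ∈ Icc a b → HasDerivAt (F i) (φ i t) t)
    (hv' : ∀ i, ∀ᵐ t, t ∈ Icc a b →
      v' i t = -(κ i ^ 2 * u i t) + κ i * θ i t - (β + s t) * (κ i * u i t) + F i t)
    (hθ' : ∀ i, ∀ᵐ t, t ∈ Icc a b → θ' i t = -(κ i * θ i t) - κ i * v i t + γ i t)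
    (hσs : ∀ t ∈ Icc a b, ∑ i ∈ S, κ i * u i t ^ 2 ≤ s t)
    (hs : ∀ t ∈ Icc a b, s t ≤ 5 * k ^ 2) (hβs : ∀ t ∈ Icc a b, |β + s t| ≤ 4 * k ^ 2)
    (hE : ∀ t ∈ Icc a b,
      ∑ i ∈ S, (κ i * u i t) ^ 2 + ∑ i ∈ S, v i t ^ 2 + ∑ i ∈ S, θ i t ^ 2 ≤ 8 * k ^ 4)
    (hFF : ∀ t ∈ Icc a b, ∑ i ∈ S, F i t ^ 2 ≤ M ^ 2)
    (hp : ∀ t, 0 ≤ p t) (hg : ∀ t, 0 ≤ g t)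
    (hγ : ∀ t, ∀ x : ι → ℝ, |∑ i ∈ S, x i * γ i t| ≤ g t * √(∑ i ∈ S, κ i * x i ^ 2))
    (hφ : ∀ t, ∀ x : ι → ℝ, |∑ i ∈ S, x i * φ i t| ≤ p t * √(∑ i ∈ S, κ i * x i ^ 2))
    (hsi : IntervalIntegrable s volume a b)
    (hgi : IntervalIntegrable (fun t => g t ^ 2) volume a b)
    (hpi : IntervalIntegrable p volume a b) :
    modalEnergy S κ β (u · b) (v · b) (θ · b) ≤ modalEnergy S κ β (u · a) (v · a) (θ · a)
      + 8 * M * k ^ 2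
      + (∫ t in a..b, (-(3 / 4) * ε * modalEnergy S κ β (u · t) (v · t) (θ · t)
          + 4 * k ^ 4 * (s t - ∑ i ∈ S, κ i * u i t ^ 2)))
      + ∫ t in a..b, (g t ^ 2 + 3 * k * p t + ε * (4 * M ^ 4 + 8 * M * g t ^ 2)
          + 320 * ε ^ 2 * k ^ 6 * M ^ 2) := by
  have hk0 : 0 ≤ k := by linarith
  have hac := absolutelyContinuousOnInterval_modalLyapunov S κ β ε (fun i _ => hu i)
    (fun i _ => hv i) (fun i _ => hθ i) (fun i _ => hF i)
  have hrate : ∀ᵐ t, t ∈ Icc a b →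
      deriv (fun t => modalLyapunov S κ β ε (u · t) (v · t) (θ · t) (F · t)) t
        ≤ (-(3 / 4) * ε * modalEnergy S κ β (u · t) (v · t) (θ · t)
          + 4 * k ^ 4 * (s t - ∑ i ∈ S, κ i * u i t ^ 2))
          + (g t ^ 2 + 3 * k * p t + ε * (4 * M ^ 4 + 8 * M * g t ^ 2)
          + 320 * ε ^ 2 * k ^ 6 * M ^ 2) := by
    filter_upwards [ae_all_iff.mpr hdu, ae_all_iff.mpr hdv, ae_all_iff.mpr hdθ, ae_all_iff.mpr hdF,
      ae_all_iff.mpr hv', ae_all_iff.mpr hθ'] with t h1 h2 h3 h4 h5 h6 ht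
    rw [(hasDerivAt_modalLyapunov S κ β ε (fun i _ => h1 i ht) (fun i _ => h2 i ht)
      (fun i _ => h3 i ht) (fun i _ => h4 i ht)).deriv]
    refine (modal_rate_le S hM hβ hε hεM hk0 (hp t) hκ hκM (hσs t ht) (hs t ht) (hβs t ht) ?_
      (hFF t ht) (fun i => h5 i ht) (fun i => h6 i ht) (hγ t) (hg t) (hφ t _)).trans_eq (by ring)
    have := Finset.sum_nonneg fun i (_ : i ∈ S) => sq_nonneg (θ i t)
    linarith [hE t ht]
  have hcE : ContinuousOn (fun t => modalEnergy S κ β (u · t) (v · t) (θ · t)) (uIcc a b) :=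
    continuousOn_modalEnergy S κ β (fun i => (hu i).continuousOn) (fun i => (hv i).continuousOn)
      fun i => (hθ i).continuousOn
  have hcσ : ContinuousOn (fun t => ∑ i ∈ S, κ i * u i t ^ 2) (uIcc a b) := by
    have hcu := fun i => (hu i).continuousOn
    fun_prop
  have hi1 : IntervalIntegrable (fun t => -(3 / 4) * ε * modalEnergy S κ β (u · t) (v · t) (θ · t)
      + 4 * k ^ 4 * (s t - ∑ i ∈ S, κ i * u i t ^ 2)) volume a b :=
    (hcE.intervalIntegrable.const_mul _).add ((hsi.sub hcσ.intervalIntegrable).const_mul _)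
  have hi2 : IntervalIntegrable (fun t => g t ^ 2 + 3 * k * p t + ε * (4 * M ^ 4 + 8 * M * g t ^ 2)
      + 320 * ε ^ 2 * k ^ 6 * M ^ 2) volume a b :=
    ((hgi.add (hpi.const_mul _)).add
      ((intervalIntegrable_const.add (hgi.const_mul _)).const_mul _)).add intervalIntegrable_const
  have h1 := intervalIntegral.integral_mono_ae_restrict hab hac.intervalIntegrable_deriv
    (hi1.add hi2) ((ae_restrict_iff' measurableSet_Icc).mpr hrate)
  rw [hac.integral_deriv_eq_sub, intervalIntegral.integral_add hi1 hi2] at h1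
  have hclose : ∀ t ∈ Icc a b, |modalLyapunov S κ β ε (u · t) (v · t) (θ · t) (F · t)
      - modalEnergy S κ β (u · t) (v · t) (θ · t)| ≤ 4 * M * k ^ 2 := fun t ht =>
    abs_modalLyapunov_sub_le S hM hε hεk hk hκ hκM ((hσs t ht).trans (hs t ht)) (hE t ht) (hFF t ht)
  have ha := abs_le.mp (hclose a (left_mem_Icc.mpr hab))
  have hb := abs_le.mp (hclose b (right_mem_Icc.mpr hab))
  linarith [ha.1, ha.2, hb.1, hb.2]

end Modal

/-! ### The data of the problem -/

section Data

variable {H : Type*} [NormedAddCommGroup H] [InnerProductSpace ℝ H] [CompleteSpace H]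
  {A : H →ₗ.[ℝ] H} {Q : ℝ} {f' g : ℝ → HScaleDual A 1}

namespace TranslationBoundedBy

/-- An interval `[a, b]` is covered by at most `b - a + 1` intervals of length one. -/
theorem lintegral_le (h : TranslationBoundedBy A f' g Q) {a b : ℝ} (ha : 0 ≤ a)
    (hab : a ≤ b) :
    ∫⁻ τ in Icc a b, (‖f' τ‖ₑ ^ 2 + ‖g τ‖ₑ ^ 2) ≤ ENNReal.ofReal ((b - a + 1) * Q) := by
  have hn : ∀ n : ℕ, ∫⁻ τ in Icc a (a + n), (‖f' τ‖ₑ ^ 2 + ‖g τ‖ₑ ^ 2)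
      ≤ n * ENNReal.ofReal Q := by
    intro n
    induction n with
    | zero => simp
    | succ n ih =>
      have hsub : Icc a (a + (n + 1 : ℕ)) ⊆ Icc a (a + n) ∪ Icc (a + n) (a + n + 1) := by
        intro x hx
        rcases le_total x (a + n) with h1 | h1
        · exact Or.inl ⟨hx.1, h1⟩
        · refine Or.inr ⟨h1, ?_⟩
          have := hx.2
          push_cast at this
          linarith
      refine (lintegral_mono_set hsub).trans ((lintegral_union_le _ _ _).trans ?_)
      push_cast
      rw [add_mul, one_mul]
      exact add_le_add ih (h.2.2 (a + n) (by positivity))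
  have hb : b ≤ a + (⌈b - a⌉₊ : ℕ) := by linarith [Nat.le_ceil (b - a)]
  refine (lintegral_mono_set (Icc_subset_Icc_right hb)).trans ((hn _).trans ?_)
  rw [ENNReal.ofReal_mul (by linarith)]
  gcongr
  rw [← ENNReal.ofReal_natCast]
  exact ENNReal.ofReal_le_ofReal (Nat.ceil_lt_add_one (by linarith)).le

theorem aestronglyMeasurable_restrict (h : TranslationBoundedBy A f' g Q) {a b : ℝ} (ha : 0 ≤ a) :
    AEStronglyMeasurable f' (volume.restrict (Icc a b)) ∧
      AEStronglyMeasurable g (volume.restrict (Icc a b)) :=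
  ⟨h.1.mono_set fun _ hx => ha.trans hx.1, h.2.1.mono_set fun _ hx => ha.trans hx.1⟩

theorem enorm_norm_sq_add (x y : HScaleDual A 1) :
    ‖(‖x‖ ^ 2 + ‖y‖ ^ 2 : ℝ)‖ₑ = ‖x‖ₑ ^ 2 + ‖y‖ₑ ^ 2 := by
  rw [Real.enorm_of_nonneg (by positivity), ENNReal.ofReal_add (by positivity) (by positivity),
    ENNReal.ofReal_pow (norm_nonneg _), ENNReal.ofReal_pow (norm_nonneg _), ofReal_norm, ofReal_norm]

theorem integrableOn (h : TranslationBoundedBy A f' g Q) {a b : ℝ} (ha : 0 ≤ a) (hab : a ≤ b) :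
    IntegrableOn (fun t => ‖f' t‖ ^ 2 + ‖g t‖ ^ 2) (Icc a b) := by
  obtain ⟨h1, h2⟩ := h.aestronglyMeasurable_restrict (b := b) ha
  refine ⟨(h1.norm.pow 2).add (h2.norm.pow 2), ?_⟩
  rw [hasFiniteIntegral_iff_enorm]
  simp only [enorm_norm_sq_add]
  exact (h.lintegral_le ha hab).trans_lt ENNReal.ofReal_lt_top

theorem integral_le (hQ : 0 ≤ Q) (h : TranslationBoundedBy A f' g Q) {a b : ℝ} (ha : 0 ≤ a)
    (hab : a ≤ b) :
    ∫ t in a..b, (‖f' t‖ ^ 2 + ‖g t‖ ^ 2) ≤ (b - a + 1) * Q := by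
  rw [intervalIntegral.integral_of_le hab, ← integral_Icc_eq_integral_Ioc]
  have h1 := ofReal_integral_norm_eq_lintegral_enorm (h.integrableOn ha hab)
  simp only [enorm_norm_sq_add] at h1
  have h2 : ∀ t, ‖(‖f' t‖ ^ 2 + ‖g t‖ ^ 2 : ℝ)‖ = ‖f' t‖ ^ 2 + ‖g t‖ ^ 2 := fun t =>
    Real.norm_of_nonneg (by positivity)
  simp only [h2] at h1
  have h3 := h.lintegral_le ha hab
  rw [← h1] at h3
  exact (ENNReal.ofReal_le_ofReal_iff (mul_nonneg (by linarith) hQ)).mp h3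

theorem intervalIntegrable_sq (h : TranslationBoundedBy A f' g Q) {a b : ℝ} (ha : 0 ≤ a)
    (hab : a ≤ b) :
    IntervalIntegrable (fun t => ‖f' t‖ ^ 2) volume a b ∧
      IntervalIntegrable (fun t => ‖g t‖ ^ 2) volume a b := by
  obtain ⟨h1, h2⟩ := h.aestronglyMeasurable_restrict (b := b) ha
  have h3 := h.integrableOn ha hab
  constructor
  · rw [intervalIntegrable_iff_integrableOn_Icc_of_le hab]
    refine h3.mono' (h1.norm.pow 2) (Filter.Eventually.of_forall fun t => ?_)
    rw [Real.norm_of_nonneg (by positivity)]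
    linarith [sq_nonneg ‖g t‖]
  · rw [intervalIntegrable_iff_integrableOn_Icc_of_le hab]
    refine h3.mono' (h2.norm.pow 2) (Filter.Eventually.of_forall fun t => ?_)
    rw [Real.norm_of_nonneg (by positivity)]
    linarith [sq_nonneg ‖f' t‖]

theorem intervalIntegrable_norm (h : TranslationBoundedBy A f' g Q) {a b : ℝ} (ha : 0 ≤ a)
    (hab : a ≤ b) :
    IntervalIntegrable (fun t => ‖f' t‖) volume a b ∧
      IntervalIntegrable (fun t => ‖g t‖) volume a b := by
  obtain ⟨h1, h2⟩ := h.aestronglyMeasurable_restrict (b := b) ha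
  obtain ⟨h3, h4⟩ := h.intervalIntegrable_sq ha hab
  rw [intervalIntegrable_iff_integrableOn_Icc_of_le hab] at h3 h4 ⊢
  rw [intervalIntegrable_iff_integrableOn_Icc_of_le hab]
  have h5 : IntegrableOn (fun _ : ℝ => (1 : ℝ)) (Icc a b) := by simp
  constructor
  · refine (h5.add h3).mono' h1.norm (Filter.Eventually.of_forall fun t => ?_)
    rw [norm_norm]
    simp only [Pi.add_apply]
    nlinarith [sq_nonneg (‖f' t‖ - 1), norm_nonneg (f' t)]
  · refine (h5.add h4).mono' h2.norm (Filter.Eventually.of_forall fun t => ?_)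
    rw [norm_norm]
    simp only [Pi.add_apply]
    nlinarith [sq_nonneg (‖g t‖ - 1), norm_nonneg (g t)]

theorem intervalIntegrable_apply (h : TranslationBoundedBy A f' g Q) {a b : ℝ} (ha : 0 ≤ a)
    (hab : a ≤ b) (w : HScale A 1) :
    IntervalIntegrable (fun t => f' t w) volume a b ∧
      IntervalIntegrable (fun t => g t w) volume a b := by
  obtain ⟨h1, h2⟩ := h.aestronglyMeasurable_restrict (b := b) ha
  obtain ⟨h3, h4⟩ := h.intervalIntegrable_norm ha hab
  rw [intervalIntegrable_iff_integrableOn_Icc_of_le hab] at h3 h4 ⊢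
  rw [intervalIntegrable_iff_integrableOn_Icc_of_le hab]
  constructor
  · exact (h3.mul_const ‖w‖).mono' 
      ((ContinuousLinearMap.apply ℝ ℝ w).continuous.comp_aestronglyMeasurable h1)
      (Filter.Eventually.of_forall fun t => (f' t).le_opNorm w)
  · exact (h4.mul_const ‖w‖).mono' 
      ((ContinuousLinearMap.apply ℝ ℝ w).continuous.comp_aestronglyMeasurable h2)
      (Filter.Eventually.of_forall fun t => (g t).le_opNorm w)

end TranslationBoundedBy

namespace EssBoundedBy

variable {f : ℝ → H} {F : ℝ}

omit [CompleteSpace H] in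
theorem integrableOn_inner (h : EssBoundedBy f F) (x : H) {s : Set ℝ} (hs : s ⊆ Ici 0)
    (hsf : volume s < ⊤) : IntegrableOn (fun t => ⟪x, f t⟫_ℝ) s := by
  have hle := Measure.restrict_mono_set volume hs
  refine (integrableOn_const (C := ‖x‖ * F) hsf.ne).mono'
    (aestronglyMeasurable_const.inner (h.1.mono_set hs)) ?_
  filter_upwards [ae_mono hle h.2] with t ht
  exact (norm_inner_le_norm _ _).trans (by gcongr)

omit [CompleteSpace H] in
theorem intervalIntegrable_inner (h : EssBoundedBy f F) (x : H) {T : ℝ} (hT : 0 ≤ T) :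
    IntervalIntegrable (fun t => ⟪x, f t⟫_ℝ) volume 0 T := by
  rw [intervalIntegrable_iff_integrableOn_Icc_of_le hT]
  exact h.integrableOn_inner x (fun t ht => ht.1) (by simp)

omit [CompleteSpace H] in
theorem locallyIntegrableOn_inner (h : EssBoundedBy f F) (x : H) :
    LocallyIntegrableOn (fun t => ⟪x, f t⟫_ℝ) (Ioi 0) := by
  rw [locallyIntegrableOn_iff isLocallyClosed_Ioi]
  intro k hk hc
  exact h.integrableOn_inner x (hk.trans Ioi_subset_Ici_self) hc.measure_lt_top

end EssBoundedBy

/-- The coordinates of `f` have absolutely continuous representatives `∫ φ i`, with constants `C i`,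
and these satisfy the bound of `f` at every time. -/
theorem exists_representative {ι : Type*} [Countable ι] {c F : ℝ} {b : HilbertBasis ι ℝ H}
    {lam : ι → ℝ} {f : ℝ → H} (h : IsEigenbasis A c b lam) (hf : EssBoundedBy f F)
    (hd : IsDistribDeriv A f f') (hT : TranslationBoundedBy A f' g Q) :
    ∃ C : ι → ℝ,
      (∀ i, ∀ᵐ t, t ∈ Ioi (0 : ℝ) → ⟪b i, f t⟫_ℝ = C i + ∫ s in (0 : ℝ)..t, f' s (h.vec 1 i)) ∧
      ∀ (S : Finset ι) (t : ℝ), 0 ≤ t →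
        ∑ i ∈ S, (C i + ∫ s in (0 : ℝ)..t, f' s (h.vec 1 i)) ^ 2 ≤ F ^ 2 := by
  have hint : ∀ i, ∀ T, 0 ≤ T → IntervalIntegrable (fun t => f' t (h.vec 1 i)) volume 0 T :=
    fun i T hT0 => (hT.intervalIntegrable_apply le_rfl hT0 _).1
  choose C hC using fun i => exists_eq_const_add_integral_of_distribDeriv
    (hf.locallyIntegrableOn_inner (b i)) (hint i) (fun φ h1 h2 h3 => by
      have := hd (h.vec 1 i) φ h1 h2 h3
      simpa only [h.incl_vec, real_inner_comm] using this)
  refine ⟨C, hC, fun S t ht => ?_⟩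
  -- the bound holds almost everywhere, hence everywhere by continuity
  have hae : ∀ᵐ t, t ∈ Ioi (0 : ℝ) →
      ∑ i ∈ S, (C i + ∫ s in (0 : ℝ)..t, f' s (h.vec 1 i)) ^ 2 ≤ F ^ 2 := by
    have h1 : ∀ᵐ t, t ∈ Ici (0 : ℝ) → ‖f t‖ ≤ F := (ae_restrict_iff' measurableSet_Ici).mp hf.2
    filter_upwards [ae_all_iff.mpr hC, h1] with t h2 h3 ht
    have h4 : ∑ i ∈ S, (C i + ∫ s in (0 : ℝ)..t, f' s (h.vec 1 i)) ^ 2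
        = ∑ i ∈ S, ⟪b i, f t⟫_ℝ ^ 2 := Finset.sum_congr rfl fun i _ => by rw [h2 i ht]
    rw [h4]
    refine (sum_le_hasSum S (fun i _ => sq_nonneg _) (IsEigenbasis.hasSum_sq b (f t))).trans ?_
    have := h3 (Ioi_subset_Ici_self ht)
    gcongr
  have hcont : ContinuousOn
      (fun t => ∑ i ∈ S, (C i + ∫ s in (0 : ℝ)..t, f' s (h.vec 1 i)) ^ 2) (Icc 0 (t + 1)) := by
    have h1 : ∀ i, ContinuousOn (fun t => ∫ s in (0 : ℝ)..t, f' s (h.vec 1 i)) (Icc 0 (t + 1)) := by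
      intro i
      have := intervalIntegral.continuousOn_primitive_interval'
        (hint i (t + 1) (by linarith)) left_mem_uIcc
      rwa [uIcc_of_le (by linarith)] at this
    fun_prop
  by_contra hcon
  push Not at hcon
  have hlt : (0 : ℝ) < t + 1 := by linarith
  have hmem : t ∈ closure (Ioo 0 (t + 1)) := by
    rw [closure_Ioo hlt.ne]; exact ⟨ht, by linarith⟩
  have hev := (hcont t ⟨ht, by linarith⟩).eventually (lt_mem_nhds hcon)
  rw [eventually_nhdsWithin_iff, eventually_nhds_iff] at hev
  obtain ⟨U, hU, hUo, htU⟩ := hev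
  have hne : (U ∩ Ioo 0 (t + 1)).Nonempty := mem_closure_iff.mp hmem U hUo htU
  have hpos : 0 < volume (U ∩ Ioo 0 (t + 1)) := (hUo.inter isOpen_Ioo).measure_pos volume hne
  refine hpos.ne' (measure_mono_null (fun x hx => ?_) (ae_iff.mp hae))
  simp only [mem_ofPred_eq, Classical.not_imp]
  exact ⟨hx.2.1, not_le.mpr (hU x hx.1 (Ioo_subset_Icc_self hx.2))⟩

end Data

/-! ### Finitely many modes of a weak solution -/

theorem absolutelyContinuousOnInterval_primitive {y : ℝ → ℝ} {a T : ℝ} (ha : 0 ≤ a) (haT : a ≤ T)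
    (hy : IntervalIntegrable y volume 0 T) (C : ℝ) :
    AbsolutelyContinuousOnInterval (fun t => C + ∫ s in (0 : ℝ)..t, y s) a T := by
  have h1 := hy.absolutelyContinuousOnInterval_intervalIntegral (c := 0) left_mem_uIcc
  refine AbsolutelyContinuousOnInterval.fun_add
    (contDiff_const.contDiffOn).absolutelyContinuousOnInterval (h1.mono ?_)
  rw [uIcc_of_le haT, uIcc_of_le (ha.trans haT)]
  exact Icc_subset_Icc_left ha

theorem ae_hasDerivAt_primitive {y : ℝ → ℝ} {a T : ℝ} (ha : 0 ≤ a)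
    (hy : IntervalIntegrable y volume 0 T) (C : ℝ) :
    ∀ᵐ t, t ∈ Icc a T → HasDerivAt (fun t => C + ∫ s in (0 : ℝ)..t, y s) (y t) t := by
  filter_upwards [hy.ae_hasDerivAt_integral] with t ht htm
  have h1 : t ∈ uIcc 0 T := by
    rw [uIcc_of_le ((ha.trans htm.1).trans htm.2)]
    exact ⟨ha.trans htm.1, htm.2⟩
  exact (ht h1 0 left_mem_uIcc).const_add C

section Solution

variable {H : Type*} [NormedAddCommGroup H] [InnerProductSpace ℝ H] [CompleteSpace H]
  {A : H →ₗ.[ℝ] H} {c β F Q : ℝ} {f : ℝ → H} {f' g : ℝ → HScaleDual A 1}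
  {u : ℝ → HScale A 2} {v θ : ℝ → H} {ι : Type*} {b : HilbertBasis ι ℝ H} {lam : ι → ℝ}

theorem phaseNorm_sq (x : HScale A 2) (y z : H) :
    phaseNorm x y z ^ 2 = ‖x‖ ^ 2 + ‖y‖ ^ 2 + ‖z‖ ^ 2 :=
  Real.sq_sqrt (by positivity)

theorem energy_eq (x : HScale A 2) (y z : H) :
    energy β x y z = 1 / 2 * (‖x‖ ^ 2 + ‖y‖ ^ 2 + ‖z‖ ^ 2) + 1 / 4 * (β + normOneSq x) ^ 2 := by
  rw [energy, phaseNorm_sq]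

theorem energy_nonneg (x : HScale A 2) (y z : H) : 0 ≤ energy β x y z := by
  rw [energy_eq]; positivity

/-- The norms that are controlled by the energy. The nonlinear part bounds `‖x‖₁²` by the square root
of the energy. -/
theorem bounds_of_energy_le {M k : ℝ} (hM : 2 ≤ M) (hβ : |β| ≤ M) (hk : M ≤ k) {x : HScale A 2}
    {y z : H} (hE : energy β x y z ≤ 4 * k ^ 4) :
    ‖x‖ ^ 2 + ‖y‖ ^ 2 + ‖z‖ ^ 2 ≤ 8 * k ^ 4 ∧ |β + normOneSq x| ≤ 4 * k ^ 2 ∧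
      normOneSq x ≤ 5 * k ^ 2 := by
  rw [energy_eq] at hE
  have h1 : |β + normOneSq x| ≤ 4 * k ^ 2 := by
    refine abs_le_of_sq_le_sq ?_ (by positivity)
    have : 0 ≤ ‖x‖ ^ 2 + ‖y‖ ^ 2 + ‖z‖ ^ 2 := by positivity
    nlinarith
  refine ⟨by nlinarith [sq_nonneg (β + normOneSq x)], h1, ?_⟩
  have h2 : M ≤ k ^ 2 := by nlinarith
  linarith [le_abs_self (β + normOneSq x), neg_abs_le β]

namespace IsWeakSolution

theorem continuousOn_incl (h : IsEigenbasis A c b lam) (hsol : IsWeakSolution A β f g u v θ) :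
    ContinuousOn (fun t => (u t).incl) (Ici 0) :=
  h.continuous_incl.comp_continuousOn hsol.continuousOn_u

theorem continuousOn_normOneSq (h : IsEigenbasis A c b lam)
    (hsol : IsWeakSolution A β f g u v θ) : ContinuousOn (fun t => normOneSq (u t)) (Ici 0) :=
  h.continuous_normOneSq.comp_continuousOn hsol.continuousOn_u

/-- The energy is continuous, since `‖·‖₁²` is continuous on `H^2`. -/
theorem continuousOn_energy (h : IsEigenbasis A c b lam)
    (hsol : IsWeakSolution A β f g u v θ) :
    ContinuousOn (fun t => energy β (u t) (v t) (θ t)) (Ici 0) := by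
  simp only [energy_eq]
  have h1 := hsol.continuousOn_normOneSq h
  have h2 := hsol.continuousOn_u.norm
  have h3 := hsol.continuousOn_v.norm
  have h4 := hsol.continuousOn_θ.norm
  fun_prop

/-- The `i`-th coordinate of `u` is a primitive of that of `v`. -/
theorem coord_u (h : IsEigenbasis A c b lam) (hsol : IsWeakSolution A β f g u v θ) (i : ι) {t : ℝ}
    (ht : 0 ≤ t) :
    ⟪b i, (u t).incl⟫_ℝ = ⟪b i, (u 0).incl⟫_ℝ + ∫ s in (0 : ℝ)..t, ⟪b i, v s⟫_ℝ := by
  have hsub : Icc 0 t ⊆ Ici 0 := fun x hx => hx.1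
  have h1 : ContinuousOn (fun s => ⟪b i, v s⟫_ℝ) (Icc 0 t) :=
    continuousOn_const.inner (hsol.continuousOn_v.mono hsub)
  have h2 : ContinuousOn (fun s => ⟪b i, (u s).incl⟫_ℝ) (Icc 0 t) :=
    continuousOn_const.inner ((hsol.continuousOn_incl h).mono hsub)
  have h3 := intervalIntegral.integral_eq_sub_of_hasDerivAt_of_le ht h2 (f' := fun s => ⟪b i, v s⟫_ℝ)
    (fun s hs => by
      have h4 := (hsol.deriv_u s hs.1.le).hasDerivAt (Ici_mem_nhds hs.1)
      exact (innerSL ℝ (b i)).hasFDerivAt.comp_hasDerivAt s h4)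
    (h1.intervalIntegrable_of_Icc ht)
  rw [h3]; ring

/-- The equation for the `i`-th coordinate of `v`. -/
theorem coord_v (h : IsEigenbasis A c b lam) (hsol : IsWeakSolution A β f g u v θ) (i : ι) {t : ℝ}
    (ht : 0 ≤ t) :
    ⟪b i, v t⟫_ℝ = ⟪b i, v 0⟫_ℝ + ∫ s in (0 : ℝ)..t, (-(√(lam i) ^ 2 * ⟪b i, (u s).incl⟫_ℝ)
      + √(lam i) * ⟪b i, θ s⟫_ℝ
      - (β + normOneSq (u s)) * (√(lam i) * ⟪b i, (u s).incl⟫_ℝ) + ⟪b i, f s⟫_ℝ) := by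
  have h1 := hsol.eq_u (h.vec 2 i) t ht
  rw [h.incl_vec, real_inner_comm, real_inner_comm (b i) (v 0)] at h1
  rw [h1]
  congr 1
  refine intervalIntegral.integral_congr fun s _ => ?_
  simp only [h.root_vec, IsEigenbasis.rpow_two_div_four, real_inner_smul_right,
    real_inner_comm (b i), h.inner_root]
  ring

/-- The equation for the `i`-th coordinate of `θ`. -/
theorem coord_θ (h : IsEigenbasis A c b lam) (hsol : IsWeakSolution A β f g u v θ) (i : ι) {t : ℝ}
    (ht : 0 ≤ t) :
    ⟪b i, θ t⟫_ℝ = ⟪b i, θ 0⟫_ℝ + ∫ s in (0 : ℝ)..t, (-(√(lam i) * ⟪b i, θ s⟫_ℝ)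
      - √(lam i) * ⟪b i, v s⟫_ℝ + g s (h.vec 1 i)) := by
  have h1 := hsol.eq_θ (h.vec 2 i) (h.vec 1 i) rfl t ht
  rw [h.incl_vec, real_inner_comm, real_inner_comm (b i) (θ 0)] at h1
  rw [h1]
  congr 1
  refine intervalIntegral.integral_congr fun s _ => ?_
  simp only [h.root_vec, IsEigenbasis.rpow_two_div_four, real_inner_smul_right,
    real_inner_comm (b i)]

/-- The dissipation inequality for the finitely many modes in `S` of a weak solution. -/
theorem modalEnergy_le [Countable ι] (h : IsEigenbasis A c b lam)
    (hsol : IsWeakSolution A β f g u v θ) (hf : EssBoundedBy f F) (hd : IsDistribDeriv A f f')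
    (hT : TranslationBoundedBy A f' g Q) (hF0 : 0 ≤ F) {M ε k a T : ℝ} (ha : 0 ≤ a) (haT : a ≤ T)
    (hM : 2 ≤ M) (hβ : |β| ≤ M) (hc : c⁻¹ ≤ M) (hF : F ≤ M) (hε : 0 ≤ ε)
    (hεM : 24 * M * ε ≤ 1) (hεk : 8 * M ^ 2 * ε * k ^ 2 ≤ 1) (hk : M ≤ k)
    (hE : ∀ t ∈ Icc a T, energy β (u t) (v t) (θ t) ≤ 4 * k ^ 4) (S : Finset ι) :
    modalEnergy S (fun i => √(lam i)) β (fun i => ⟪b i, (u T).incl⟫_ℝ) (fun i => ⟪b i, v T⟫_ℝ)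
        (fun i => ⟪b i, θ T⟫_ℝ)
      ≤ modalEnergy S (fun i => √(lam i)) β (fun i => ⟪b i, (u a).incl⟫_ℝ) (fun i => ⟪b i, v a⟫_ℝ)
        (fun i => ⟪b i, θ a⟫_ℝ) + 8 * M * k ^ 2
      + (∫ t in a..T, (-(3 / 4) * ε * modalEnergy S (fun i => √(lam i)) β
          (fun i => ⟪b i, (u t).incl⟫_ℝ) (fun i => ⟪b i, v t⟫_ℝ) (fun i => ⟪b i, θ t⟫_ℝ)
          + 4 * k ^ 4 * (normOneSq (u t) - ∑ i ∈ S, √(lam i) * ⟪b i, (u t).incl⟫_ℝ ^ 2)))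
      + ∫ t in a..T, (‖g t‖ ^ 2 + 3 * k * ‖f' t‖ + ε * (4 * M ^ 4 + 8 * M * ‖g t‖ ^ 2)
          + 320 * ε ^ 2 * k ^ 6 * M ^ 2) := by
  have hT0 : 0 ≤ T := ha.trans haT
  have hsubT : uIcc 0 T ⊆ Ici 0 := by
    rw [uIcc_of_le hT0]; exact fun x hx => hx.1
  obtain ⟨C, hC, hCF⟩ := exists_representative h hf hd hT
  have hcu : ∀ i, ContinuousOn (fun t => ⟪b i, (u t).incl⟫_ℝ) (uIcc 0 T) := fun i =>
    continuousOn_const.inner ((hsol.continuousOn_incl h).mono hsubT)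
  have hcv : ∀ i, ContinuousOn (fun t => ⟪b i, v t⟫_ℝ) (uIcc 0 T) := fun i =>
    continuousOn_const.inner (hsol.continuousOn_v.mono hsubT)
  have hcθ : ∀ i, ContinuousOn (fun t => ⟪b i, θ t⟫_ℝ) (uIcc 0 T) := fun i =>
    continuousOn_const.inner (hsol.continuousOn_θ.mono hsubT)
  have hcs : ContinuousOn (fun t => normOneSq (u t)) (uIcc 0 T) :=
    (hsol.continuousOn_normOneSq h).mono hsubT
  have hiv : ∀ i, IntervalIntegrable (fun s => -(√(lam i) ^ 2 * ⟪b i, (u s).incl⟫_ℝ)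
      + √(lam i) * ⟪b i, θ s⟫_ℝ
      - (β + normOneSq (u s)) * (√(lam i) * ⟪b i, (u s).incl⟫_ℝ) + ⟪b i, f s⟫_ℝ) volume 0 T := by
    intro i
    refine IntervalIntegrable.add (ContinuousOn.intervalIntegrable ?_)
      (hf.intervalIntegrable_inner (b i) hT0)
    have h1 := hcu i
    have h2 := hcθ i
    fun_prop
  have hiθ : ∀ i, IntervalIntegrable (fun s => -(√(lam i) * ⟪b i, θ s⟫_ℝ)
      - √(lam i) * ⟪b i, v s⟫_ℝ + g s (h.vec 1 i)) volume 0 T := by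
    intro i
    refine IntervalIntegrable.add (ContinuousOn.intervalIntegrable ?_)
      (hT.intervalIntegrable_apply le_rfl hT0 _).2
    have h1 := hcv i
    have h2 := hcθ i
    fun_prop
  have hiF : ∀ i, IntervalIntegrable (fun s => f' s (h.vec 1 i)) volume 0 T := fun i =>
    (hT.intervalIntegrable_apply le_rfl hT0 _).1
  have hiu : ∀ i, IntervalIntegrable (fun t => ⟪b i, v t⟫_ℝ) volume 0 T := fun i =>
    (hcv i).intervalIntegrable
  -- the coordinates are replaced by primitives, which are also defined for negative times
  set U : ι → ℝ → ℝ := fun i t => ⟪b i, (u 0).incl⟫_ℝ + ∫ s in (0 : ℝ)..t, ⟪b i, v s⟫_ℝ with hU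
  set V : ι → ℝ → ℝ := fun i t => ⟪b i, v 0⟫_ℝ + ∫ s in (0 : ℝ)..t,
    (-(√(lam i) ^ 2 * ⟪b i, (u s).incl⟫_ℝ) + √(lam i) * ⟪b i, θ s⟫_ℝ
      - (β + normOneSq (u s)) * (√(lam i) * ⟪b i, (u s).incl⟫_ℝ) + ⟪b i, f s⟫_ℝ) with hV
  set Θ : ι → ℝ → ℝ := fun i t => ⟪b i, θ 0⟫_ℝ + ∫ s in (0 : ℝ)..t, (-(√(lam i) * ⟪b i, θ s⟫_ℝ)
      - √(lam i) * ⟪b i, v s⟫_ℝ + g s (h.vec 1 i)) with hΘ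
  set G : ι → ℝ → ℝ := fun i t => C i + ∫ s in (0 : ℝ)..t, f' s (h.vec 1 i) with hG
  have eU : ∀ i t, 0 ≤ t → ⟪b i, (u t).incl⟫_ℝ = U i t := fun i t ht => hsol.coord_u h i ht
  have eV : ∀ i t, 0 ≤ t → ⟪b i, v t⟫_ℝ = V i t := fun i t ht => hsol.coord_v h i ht
  have eΘ : ∀ i t, 0 ≤ t → ⟪b i, θ t⟫_ℝ = Θ i t := fun i t ht => hsol.coord_θ h i ht
  have hpos : ∀ t ∈ Icc a T, 0 ≤ t := fun t ht => ha.trans ht.1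
  have hM1 : 1 ≤ M := by linarith
  have hbd := fun t (ht : t ∈ Icc a T) => bounds_of_energy_le hM hβ hk (hE t ht)
  have hlast : ∀ (x : HScaleDual A 1) (y : ι → ℝ),
      |∑ i ∈ S, y i * x (h.vec 1 i)| ≤ ‖x‖ * √(∑ i ∈ S, √(lam i) * y i ^ 2) :=
    fun x y => h.abs_sum_mul_dual_le S y x
  have key := modalEnergy_le_add_integral S (κ := fun i => √(lam i)) (u := U) (v := V) (θ := Θ)
    (F := G) (γ := fun i t => g t (h.vec 1 i)) (φ := fun i t => f' t (h.vec 1 i))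
    (v' := fun i s => -(√(lam i) ^ 2 * ⟪b i, (u s).incl⟫_ℝ) + √(lam i) * ⟪b i, θ s⟫_ℝ
      - (β + normOneSq (u s)) * (√(lam i) * ⟪b i, (u s).incl⟫_ℝ) + ⟪b i, f s⟫_ℝ)
    (θ' := fun i s => -(√(lam i) * ⟪b i, θ s⟫_ℝ) - √(lam i) * ⟪b i, v s⟫_ℝ + g s (h.vec 1 i))
    (s := fun t => normOneSq (u t)) (g := fun t => ‖g t‖) (p := fun t => ‖f' t‖)
    haT hM hβ hε hεM hεk hk (fun i => Real.sqrt_pos.mpr (h.lam_pos i)) (h.le_sqrt_lam hM1 hc)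
    (fun i => absolutelyContinuousOnInterval_primitive ha haT (hiu i) _)
    (fun i => absolutelyContinuousOnInterval_primitive ha haT (hiv i) _)
    (fun i => absolutelyContinuousOnInterval_primitive ha haT (hiθ i) _)
    (fun i => absolutelyContinuousOnInterval_primitive ha haT (hiF i) _)
    (fun i => ?_) (fun i => ae_hasDerivAt_primitive ha (hiv i) _)
    (fun i => ae_hasDerivAt_primitive ha (hiθ i) _) (fun i => ae_hasDerivAt_primitive ha (hiF i) _)
    (fun i => ?_) (fun i => ?_) (fun t ht => ?_) (fun t ht => (hbd t ht).2.2)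
    (fun t ht => (hbd t ht).2.1) (fun t ht => ?_) (fun t ht => ?_) (fun t => norm_nonneg _)
    (fun t => norm_nonneg _) (fun t y => hlast (g t) y) (fun t y => hlast (f' t) y) ?_
    (hT.intervalIntegrable_sq ha haT).2 (hT.intervalIntegrable_norm ha haT).1
  · simp only [eU _ T hT0, eV _ T hT0, eΘ _ T hT0, eU _ a ha, eV _ a ha, eΘ _ a ha]
    refine key.trans_eq ?_
    congr 2
    refine intervalIntegral.integral_congr fun t ht => ?_
    rw [uIcc_of_le haT] at ht
    simp only [eU _ t (hpos t ht), eV _ t (hpos t ht), eΘ _ t (hpos t ht)]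
  · filter_upwards [ae_hasDerivAt_primitive ha (hiu i) ⟪b i, (u 0).incl⟫_ℝ] with t h1 ht
    rw [← eV i t (hpos t ht)]
    exact h1 ht
  · have h0 : ∀ᵐ t : ℝ, t ≠ 0 := by simp [ae_iff, measure_singleton]
    filter_upwards [hC i, h0] with t h1 h2 ht
    simp only [eU i t (hpos t ht), eΘ i t (hpos t ht)]
    rw [h1 (lt_of_le_of_ne (hpos t ht) h2.symm)]
  · refine Filter.Eventually.of_forall fun t ht => ?_
    simp only [eV i t (hpos t ht), eΘ i t (hpos t ht)]
  · simp only [← eU _ t (hpos t ht)]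
    exact sum_le_hasSum S (fun i _ => by positivity) (h.hasSum_normOneSq (u t))
  · simp only [← eU _ t (hpos t ht), ← eV _ t (hpos t ht), ← eΘ _ t (hpos t ht)]
    have h1 := sum_le_hasSum S (fun i _ => sq_nonneg _) (h.hasSum_norm_sq (u t))
    have h2 := sum_le_hasSum S (fun i _ => sq_nonneg _) (IsEigenbasis.hasSum_sq b (v t))
    have h3 := sum_le_hasSum S (fun i _ => sq_nonneg _) (IsEigenbasis.hasSum_sq b (θ t))
    linarith [(hbd t ht).1]
  · exact (hCF S t (hpos t ht)).trans (by gcongr)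
  · refine (hcs.mono ?_).intervalIntegrable
    rw [uIcc_of_le haT, uIcc_of_le hT0]
    exact Icc_subset_Icc_left ha

end IsWeakSolution

end Solution

/-! ### The dissipation inequality for a weak solution -/

section Solution

variable {H : Type*} [NormedAddCommGroup H] [InnerProductSpace ℝ H] [CompleteSpace H]
  {A : H →ₗ.[ℝ] H} {c β F Q : ℝ} {f : ℝ → H} {f' g : ℝ → HScaleDual A 1}
  {u : ℝ → HScale A 2} {v θ : ℝ → H} {ι : Type*} {b : HilbertBasis ι ℝ H} {lam : ι → ℝ}

/-- The energy is the limit of the energies of finitely many modes. -/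
theorem tendsto_modalEnergy (h : IsEigenbasis A c b lam) (β : ℝ) (x : HScale A 2) (y z : H) :
    Filter.Tendsto (fun S : Finset ι => modalEnergy S (fun i => √(lam i)) β
      (fun i => ⟪b i, x.incl⟫_ℝ) (fun i => ⟪b i, y⟫_ℝ) (fun i => ⟪b i, z⟫_ℝ)) Filter.atTop
      (nhds (energy β x y z)) := by
  rw [energy_eq]
  have h1 : Filter.Tendsto (fun S : Finset ι => ∑ i ∈ S, (√(lam i) * ⟪b i, x.incl⟫_ℝ) ^ 2)
    Filter.atTop (nhds (‖x‖ ^ 2)) := h.hasSum_norm_sq x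
  have h2 : Filter.Tendsto (fun S : Finset ι => ∑ i ∈ S, ⟪b i, y⟫_ℝ ^ 2)
    Filter.atTop (nhds (‖y‖ ^ 2)) := IsEigenbasis.hasSum_sq b y
  have h3 : Filter.Tendsto (fun S : Finset ι => ∑ i ∈ S, ⟪b i, z⟫_ℝ ^ 2)
    Filter.atTop (nhds (‖z‖ ^ 2)) := IsEigenbasis.hasSum_sq b z
  have h4 : Filter.Tendsto (fun S : Finset ι => ∑ i ∈ S, √(lam i) * ⟪b i, x.incl⟫_ℝ ^ 2)
    Filter.atTop (nhds (normOneSq x)) := h.hasSum_normOneSq x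
  exact (((h1.add h2).add h3).const_mul _).add (((h4.const_add β).pow 2).const_mul _)

/-- The contribution of `g` and `∂ₜ f` to the dissipation inequality, for a small parameter `ε`; here
`x` and `y` stand for `‖∂ₜ f‖₋₁` and `‖g‖₋₁`. -/
theorem forcing_le {M k ε : ℝ} (hM : 2 ≤ M) (hk : M ≤ k) (hε : 0 ≤ ε) (hMε : M * ε ≤ 1 / 2560)
    (hεk : 2560 * M ^ 2 * k ^ 2 * ε = 1) (x y : ℝ) :
    y ^ 2 + 3 * k * x + ε * (4 * M ^ 4 + 8 * M * y ^ 2)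
      ≤ 5 * k * (x ^ 2 + y ^ 2) + (3 * k + M ^ 2) := by
  have hk0 : 0 ≤ k := by linarith
  have e1 : 3 * k * x ≤ 3 * k * (1 + x ^ 2) := by
    have : x ≤ 1 + x ^ 2 := by nlinarith [sq_nonneg (x - 1)]
    gcongr
  have e3 : M * ε * y ^ 2 ≤ 1 / 2560 * y ^ 2 := by gcongr
  have e4 : ε * (4 * M ^ 4) ≤ M ^ 2 := by
    have h1 : 1 ≤ k ^ 2 := one_le_pow₀ (by linarith)
    have h2 : 4 * M ^ 2 * ε * 1 ≤ 4 * M ^ 2 * ε * k ^ 2 := by gcongr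
    have h3 : M ^ 2 * (4 * M ^ 2 * ε) ≤ M ^ 2 * 1 := by
      refine mul_le_mul_of_nonneg_left ?_ (by positivity)
      linarith
    linarith
  have e5 : 2 * y ^ 2 ≤ 5 * k * y ^ 2 :=
    mul_le_mul_of_nonneg_right (by linarith) (sq_nonneg _)
  have e6 : 0 ≤ k * x ^ 2 := by positivity
  linarith [sq_nonneg y]

namespace IsWeakSolution

/-- The dissipation inequality for a weak solution: the limit of `modalEnergy_le`. -/
theorem energy_le_add_integral [Countable ι] (h : IsEigenbasis A c b lam)
    (hsol : IsWeakSolution A β f g u v θ) (hf : EssBoundedBy f F) (hd : IsDistribDeriv A f f')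
    (hT : TranslationBoundedBy A f' g Q) (hF0 : 0 ≤ F) {M ε k a T : ℝ} (ha : 0 ≤ a) (haT : a ≤ T)
    (hM : 2 ≤ M) (hβ : |β| ≤ M) (hc : c⁻¹ ≤ M) (hF : F ≤ M) (hε : 0 ≤ ε)
    (hεM : 24 * M * ε ≤ 1) (hεk : 8 * M ^ 2 * ε * k ^ 2 ≤ 1) (hk : M ≤ k)
    (hE : ∀ t ∈ Icc a T, energy β (u t) (v t) (θ t) ≤ 4 * k ^ 4) :
    energy β (u T) (v T) (θ T) ≤ energy β (u a) (v a) (θ a) + 8 * M * k ^ 2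
      + (∫ t in a..T, -(3 / 4) * ε * energy β (u t) (v t) (θ t))
      + ∫ t in a..T, (‖g t‖ ^ 2 + 3 * k * ‖f' t‖ + ε * (4 * M ^ 4 + 8 * M * ‖g t‖ ^ 2)
          + 320 * ε ^ 2 * k ^ 6 * M ^ 2) := by
  have hsubT : Icc a T ⊆ Ici 0 := fun x hx => ha.trans hx.1
  refine le_of_tendsto_of_tendsto' (tendsto_modalEnergy h β (u T) (v T) (θ T))
    ((((tendsto_modalEnergy h β (u a) (v a) (θ a)).add_const _).add ?_).add_const _)
    fun S => hsol.modalEnergy_le h hf hd hT hF0 ha haT hM hβ hc hF hε hεM hεk hk hE S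
  refine intervalIntegral.tendsto_integral_filter_of_dominated_convergence
    (fun _ => 3 / 4 * ε * (13 * k ^ 4) + 4 * k ^ 4 * (5 * k ^ 2)) ?_ ?_ intervalIntegrable_const ?_
  · refine Filter.Eventually.of_forall fun S => ?_
    refine ContinuousOn.aestronglyMeasurable ?_ measurableSet_uIoc
    have hsub : uIoc a T ⊆ Ici 0 := by
      rw [uIoc_of_le haT]; exact Ioc_subset_Icc_self.trans hsubT
    have hcu : ∀ i, ContinuousOn (fun t => ⟪b i, (u t).incl⟫_ℝ) (uIoc a T) := fun i =>
      continuousOn_const.inner ((hsol.continuousOn_incl h).mono hsub)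
    have hcv : ∀ i, ContinuousOn (fun t => ⟪b i, v t⟫_ℝ) (uIoc a T) := fun i =>
      continuousOn_const.inner (hsol.continuousOn_v.mono hsub)
    have hcθ : ∀ i, ContinuousOn (fun t => ⟪b i, θ t⟫_ℝ) (uIoc a T) := fun i =>
      continuousOn_const.inner (hsol.continuousOn_θ.mono hsub)
    have hcs : ContinuousOn (fun t => normOneSq (u t)) (uIoc a T) :=
      (hsol.continuousOn_normOneSq h).mono hsub
    have hcσ : ContinuousOn (fun t => ∑ i ∈ S, √(lam i) * ⟪b i, (u t).incl⟫_ℝ ^ 2) (uIoc a T) :=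
      continuousOn_finsetSum S fun i _ => ((hcu i).pow 2).const_mul _
    exact ((continuousOn_modalEnergy S _ β hcu hcv hcθ).const_mul _).add
      ((hcs.sub hcσ).const_mul _)
  · refine Filter.Eventually.of_forall fun S => Filter.Eventually.of_forall fun t ht => ?_
    rw [uIoc_of_le haT] at ht
    obtain ⟨b1, -, b3⟩ := bounds_of_energy_le hM hβ hk (hE t (Ioc_subset_Icc_self ht))
    have h1 := sum_le_hasSum S (fun i _ => sq_nonneg _) (h.hasSum_norm_sq (u t))
    have h2 := sum_le_hasSum S (fun i _ => sq_nonneg _) (IsEigenbasis.hasSum_sq b (v t))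
    have h3 := sum_le_hasSum S (fun i _ => sq_nonneg _) (IsEigenbasis.hasSum_sq b (θ t))
    have h4 := sum_le_hasSum S (fun i _ => by positivity) (h.hasSum_normOneSq (u t))
    have h5 : 0 ≤ ∑ i ∈ S, √(lam i) * ⟪b i, (u t).incl⟫_ℝ ^ 2 :=
      Finset.sum_nonneg fun i _ => by positivity
    have h6 : (β + ∑ i ∈ S, √(lam i) * ⟪b i, (u t).incl⟫_ℝ ^ 2) ^ 2 ≤ (6 * k ^ 2) ^ 2 := by
      have h7 : M ≤ k ^ 2 := by nlinarith
      refine sq_le_sq' ?_ ?_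
      · linarith [neg_abs_le β, sq_nonneg k]
      · linarith [le_abs_self β]
    have h7 : modalEnergy S (fun i => √(lam i)) β (fun i => ⟪b i, (u t).incl⟫_ℝ)
        (fun i => ⟪b i, v t⟫_ℝ) (fun i => ⟪b i, θ t⟫_ℝ) ≤ 13 * k ^ 4 := by
      unfold modalEnergy
      linarith
    have h8 : 0 ≤ modalEnergy S (fun i => √(lam i)) β (fun i => ⟪b i, (u t).incl⟫_ℝ)
        (fun i => ⟪b i, v t⟫_ℝ) (fun i => ⟪b i, θ t⟫_ℝ) := by
      unfold modalEnergy
      have := fun x : ι → ℝ => Finset.sum_nonneg fun i (_ : i ∈ S) => sq_nonneg (x i)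
      have h9 := this fun i => √(lam i) * ⟪b i, (u t).incl⟫_ℝ
      have h10 := this fun i => ⟪b i, v t⟫_ℝ
      have h11 := this fun i => ⟪b i, θ t⟫_ℝ
      positivity
    refine (norm_add_le _ _).trans (add_le_add ?_ ?_)
    · rw [Real.norm_eq_abs, abs_mul, abs_of_nonneg h8, neg_mul, abs_neg,
        abs_of_nonneg (by positivity)]
      gcongr
    · rw [Real.norm_eq_abs, abs_of_nonneg (mul_nonneg (by positivity) (sub_nonneg.mpr h4))]
      gcongr
      linarith
  · refine Filter.Eventually.of_forall fun t _ => ?_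
    have h1 : Filter.Tendsto (fun S : Finset ι => ∑ i ∈ S, √(lam i) * ⟪b i, (u t).incl⟫_ℝ ^ 2)
      Filter.atTop (nhds (normOneSq (u t))) := h.hasSum_normOneSq (u t)
    have h2 := ((tendsto_modalEnergy h β (u t) (v t) (θ t)).const_mul (-(3 / 4) * ε)).add
      ((h1.const_sub (normOneSq (u t))).const_mul (4 * k ^ 4))
    simpa only [sub_self, mul_zero, add_zero] using h2

/-- While the energy is comparable to a large number `k⁴`, it decreases, up to an error of at most
`k⁴`, with speed at least one. This is the dissipation inequality with the parameter
`ε = (2560 M² k²)⁻¹`, which makes the term `ε² k⁶` small compared with `ε k⁴ ∼ k²`. -/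
theorem energy_le_sub [Countable ι] (h : IsEigenbasis A c b lam)
    (hsol : IsWeakSolution A β f g u v θ) (hf : EssBoundedBy f F) (hd : IsDistribDeriv A f f')
    (hT : TranslationBoundedBy A f' g Q) (hF0 : 0 ≤ F) (hQ0 : 0 ≤ Q) {M k a T : ℝ} (ha : 0 ≤ a)
    (haT : a ≤ T) (hM : 2 ≤ M) (hβ : |β| ≤ M) (hc : c⁻¹ ≤ M) (hF : F ≤ M) (hQ : Q ≤ M)
    (hk : 163840 * M ^ 3 ≤ k)
    (hE : ∀ t ∈ Icc a T, k ^ 4 / 2 ≤ energy β (u t) (v t) (θ t) ∧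
      energy β (u t) (v t) (θ t) ≤ 4 * k ^ 4) :
    energy β (u T) (v T) (θ T) ≤ energy β (u a) (v a) (θ a) + k ^ 4 - (T - a) := by
  have hM0 : 0 < M := by linarith
  have hM3 : M ≤ M ^ 3 := le_self_pow₀ (by linarith) three_ne_zero
  have hMk : 163840 * M ≤ k := by linarith
  have hMk1 : M ≤ k := by linarith
  have hk1 : 1 ≤ k := by linarith
  have hk0 : 0 < k := by linarith
  set ε : ℝ := (2560 * M ^ 2 * k ^ 2)⁻¹ with hεdef
  have hε0 : 0 < ε := by positivity
  have hεeq : 2560 * M ^ 2 * k ^ 2 * ε = 1 := mul_inv_cancel₀ (by positivity)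
  have hMε : M * ε ≤ 1 / 2560 := by
    have h1 : M * ε * 1 ≤ M * ε * (M * k ^ 2) := by
      refine mul_le_mul_of_nonneg_left ?_ (by positivity)
      exact one_le_mul_of_one_le_of_one_le (by linarith) (one_le_pow₀ hk1)
    linarith
  have key := hsol.energy_le_add_integral h hf hd hT hF0 ha haT hM hβ hc hF hε0.le
    (by linarith) (by linarith) (by linarith) (fun t ht => (hE t ht).2)
  set d : ℝ := k ^ 2 / (20480 * M ^ 2) with hd_def
  have hd8 : 8 * (k * M) ≤ d := by
    rw [hd_def, le_div_iff₀ (by positivity)]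
    linarith [mul_le_mul_of_nonneg_left hk hk0.le]
  have hεk : ε * k ^ 4 = 8 * d := by
    rw [hεdef, hd_def]; field_simp; norm_num
  have hcube : 320 * ε ^ 2 * k ^ 6 * M ^ 2 = d := by
    rw [hεdef, hd_def]; field_simp; norm_num
  have hL : 0 ≤ T - a := by linarith
  have hsubT : uIcc a T ⊆ Ici 0 := by
    rw [uIcc_of_le haT]; exact fun x hx => ha.trans hx.1
  -- the dissipation
  have h1 : ∫ t in a..T, -(3 / 4) * ε * energy β (u t) (v t) (θ t) ≤ (T - a) * (-3 * d) := by
    have h2 : ∫ t in a..T, -(3 / 4) * ε * energy β (u t) (v t) (θ t) ≤ ∫ _ in a..T, -3 * d := by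
      refine intervalIntegral.integral_mono_on haT
        ((((hsol.continuousOn_energy h).mono hsubT).const_smul (-(3 / 4) * ε)).intervalIntegrable)
        intervalIntegrable_const fun t ht => ?_
      have := mul_le_mul_of_nonneg_left (hE t ht).1 hε0.le
      linarith
    rwa [intervalIntegral.integral_const, smul_eq_mul] at h2
  -- the forcing
  have h3 : ∫ t in a..T, (‖g t‖ ^ 2 + 3 * k * ‖f' t‖ + ε * (4 * M ^ 4 + 8 * M * ‖g t‖ ^ 2)
      + 320 * ε ^ 2 * k ^ 6 * M ^ 2)
      ≤ 5 * k * ((T - a + 1) * M) + (T - a) * (3 * k + M ^ 2 + d) := by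
    obtain ⟨i1, i2⟩ := hT.intervalIntegrable_sq ha haT
    obtain ⟨i3, -⟩ := hT.intervalIntegrable_norm ha haT
    have h4 : ∫ t in a..T, (‖g t‖ ^ 2 + 3 * k * ‖f' t‖ + ε * (4 * M ^ 4 + 8 * M * ‖g t‖ ^ 2)
        + 320 * ε ^ 2 * k ^ 6 * M ^ 2)
        ≤ ∫ t in a..T, (5 * k * (‖f' t‖ ^ 2 + ‖g t‖ ^ 2) + (3 * k + M ^ 2 + d)) := by
      refine intervalIntegral.integral_mono_on haT
        (((i2.add (i3.const_mul _)).add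
          ((intervalIntegrable_const.add (i2.const_mul _)).const_mul _)).add
          intervalIntegrable_const)
        (((i1.add i2).const_mul _).add intervalIntegrable_const) fun t _ => ?_
      rw [hcube]
      linarith [forcing_le hM hMk1 hε0.le hMε hεeq ‖f' t‖ ‖g t‖]
    rw [intervalIntegral.integral_add ((i1.add i2).const_mul _) intervalIntegrable_const,
      intervalIntegral.integral_const_mul, intervalIntegral.integral_const, smul_eq_mul] at h4
    refine h4.trans (add_le_add ?_ le_rfl)
    have h5 := hT.integral_le hQ0 ha haT
    have h6 : (T - a + 1) * Q ≤ (T - a + 1) * M := by gcongr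
    have h7 := h5.trans h6
    gcongr
  have h5 : (T - a) * (5 * k * M + 3 * k + M ^ 2 + d - 3 * d) ≤ (T - a) * (-1) := by
    refine mul_le_mul_of_nonneg_left ?_ hL
    have a1 : 2 * k ≤ M * k := mul_le_mul_of_nonneg_right hM hk0.le
    have a2 : M * M ≤ M * k := mul_le_mul_of_nonneg_left (by linarith) hM0.le
    linarith
  have h6 : 8 * M * k ^ 2 + 5 * k * M ≤ k ^ 4 := by
    have a1 : k * M ≤ k ^ 2 * M := by
      have : k ≤ k ^ 2 := le_self_pow₀ hk1 two_ne_zero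
      gcongr
    have a2 : 13 * M ≤ k ^ 2 := le_trans (by linarith) (le_self_pow₀ hk1 two_ne_zero)
    have a3 : 13 * M * k ^ 2 ≤ k ^ 2 * k ^ 2 := by gcongr
    linarith
  linarith

end IsWeakSolution

end Solution

/-! ### Absorption -/

/-- A continuous function that rises from `x` to a larger value `y` has a stretch on which it goes
from `x` to `y` and stays between the two. -/
theorem exists_upcrossing {φ : ℝ → ℝ} {a b x y : ℝ} (hab : a ≤ b) (hc : ContinuousOn φ (Icc a b))
    (hxy : x ≤ y) (ha : φ a ≤ x) (hb : y ≤ φ b) :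
    ∃ a' b', a ≤ a' ∧ a' ≤ b' ∧ b' ≤ b ∧ φ a' = x ∧ φ b' = y ∧
      ∀ t ∈ Icc a' b', x ≤ φ t ∧ φ t ≤ y := by
  have hcl : ∀ {p q z : ℝ}, a ≤ p → q ≤ b → IsCompact {t ∈ Icc p q | φ t = z} := by
    intro p q z hp hq
    have h1 := (hc.mono (Icc_subset_Icc hp hq)).preimage_isClosed_of_isClosed isClosed_Icc
      (isClosed_singleton (x := z))
    exact isCompact_Icc.of_isClosed_subset h1 fun t ht => ht.1
  -- the first time at which `y` is attained
  obtain ⟨b', hb'⟩ : ∃ b', IsLeast {t ∈ Icc a b | φ t = y} b' := by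
    refine (hcl le_rfl le_rfl).exists_isLeast ?_
    obtain ⟨t, ht, e⟩ := intermediate_value_Icc hab hc ⟨ha.trans hxy, hb⟩
    exact ⟨t, ht, e⟩
  obtain ⟨⟨⟨hab', hb'b⟩, eb'⟩, hmin⟩ := hb'
  -- the last time before at which `x` is attained
  obtain ⟨a', ha'⟩ : ∃ a', IsGreatest {t ∈ Icc a b' | φ t = x} a' := by
    refine (hcl le_rfl hb'b).exists_isGreatest ?_
    obtain ⟨t, ht, e⟩ := intermediate_value_Icc hab' (hc.mono (Icc_subset_Icc_right hb'b))
      ⟨ha, hxy.trans_eq eb'.symm⟩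
    exact ⟨t, ht, e⟩
  obtain ⟨⟨⟨haa', ha'b'⟩, ea'⟩, hmax⟩ := ha'
  refine ⟨a', b', haa', ha'b', hb'b, ea', eb', fun t ht => ⟨?_, ?_⟩⟩
  · by_contra hcon
    push Not at hcon
    obtain ⟨r, hr, e⟩ := intermediate_value_Icc ht.2
      (hc.mono (Icc_subset_Icc (haa'.trans ht.1) hb'b)) ⟨hcon.le, hxy.trans_eq eb'.symm⟩
    have h1 : r ≤ a' := hmax ⟨⟨(haa'.trans ht.1).trans hr.1, hr.2⟩, e⟩
    have h2 : t = a' := le_antisymm (hr.1.trans h1) ht.1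
    rw [h2, ea'] at hcon
    exact lt_irrefl _ hcon
  · by_contra hcon
    push Not at hcon
    obtain ⟨r, hr, e⟩ := intermediate_value_Icc (haa'.trans ht.1)
      (hc.mono (Icc_subset_Icc_right (ht.2.trans hb'b))) ⟨ha.trans hxy, hcon.le⟩
    have h1 : b' ≤ r := hmin ⟨⟨hr.1, (hr.2.trans ht.2).trans hb'b⟩, e⟩
    have h2 : t = b' := le_antisymm ht.2 (h1.trans hr.2)
    rw [h2, eb'] at hcon
    exact lt_irrefl _ hcon

/-- A nonnegative function that decreases with speed at least one, up to an error `K`, while it is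
comparable to `K`, for every `K ≥ K₀`, is finally at most `4 K₀`. -/
theorem le_of_decreasing_at_large_values {φ : ℝ → ℝ} {K₀ : ℝ} (hc : ContinuousOn φ (Ici 0))
    (h0 : ∀ t, 0 ≤ t → 0 ≤ φ t) (hK₀ : 0 < K₀)
    (hstep : ∀ K, K₀ ≤ K → ∀ a b, 0 ≤ a → a ≤ b → (∀ t ∈ Icc a b, K / 2 ≤ φ t ∧ φ t ≤ 4 * K) →
      φ b ≤ φ a + K - (b - a)) {R t : ℝ} (hR : φ 0 ≤ R) (ht : 6 * R ≤ t) : φ t ≤ 4 * K₀ := by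
  have hsub : ∀ {a b : ℝ}, 0 ≤ a → Icc a b ⊆ Ici 0 := fun ha x hx => ha.trans hx.1
  have hstay : ∀ K, K₀ ≤ K → ∀ a, 0 ≤ a → φ a ≤ K → ∀ t, a ≤ t → φ t ≤ 4 * K := by
    intro K hK a ha hφ t hat
    by_contra hcon
    push Not at hcon
    obtain ⟨a', b', h1, h2, -, h4, h5, h6⟩ := exists_upcrossing hat (hc.mono (hsub ha))
      (by linarith : K ≤ 4 * K) hφ hcon.le
    have h7 := hstep K hK a' b' (ha.trans h1) h2 fun s hs =>
      ⟨by linarith [(h6 s hs).1], (h6 s hs).2⟩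
    linarith
  have hhalf : ∀ K, K₀ ≤ K → ∀ a, 0 ≤ a → φ a ≤ K → ∃ t, a ≤ t ∧ t ≤ a + 3 * K ∧ φ t ≤ K / 2 := by
    intro K hK a ha hφ
    by_contra! hcon
    have h1 := hstep K hK a (a + 3 * K) ha (by linarith) fun s hs =>
      ⟨(hcon s hs.1 hs.2).le, hstay K hK a ha hφ s hs.1⟩
    have h2 := h0 (a + 3 * K) (by linarith)
    linarith
  have hreach : ∀ n : ℕ, ∀ K a, K ≤ 2 ^ n * K₀ → 0 ≤ a → φ a ≤ K →
      ∃ t, a ≤ t ∧ t ≤ a + 6 * K ∧ φ t ≤ K₀ := by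
    intro n
    induction n with
    | zero =>
      intro K a hK ha hφ
      exact ⟨a, le_rfl, by linarith [h0 a ha], by linarith⟩
    | succ n ih =>
      intro K a hK ha hφ
      rcases le_total K K₀ with h1 | h1
      · exact ⟨a, le_rfl, by linarith [h0 a ha], by linarith⟩
      · obtain ⟨t, h2, h3, h4⟩ := hhalf K h1 a ha hφ
        obtain ⟨s, h5, h6, h7⟩ := ih (K / 2) t (by rw [pow_succ] at hK; linarith) (ha.trans h2) h4
        exact ⟨s, h2.trans h5, by linarith, h7⟩
  obtain ⟨n, hn⟩ := pow_unbounded_of_one_lt (R / K₀) (one_lt_two (α := ℝ))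
  rw [div_lt_iff₀ hK₀] at hn
  obtain ⟨s, h1, h2, h3⟩ := hreach n R 0 hn.le le_rfl hR
  exact hstay K₀ le_rfl s h1 h3 t (by linarith)

section Absorbing

variable {H : Type*} [NormedAddCommGroup H] [InnerProductSpace ℝ H] [CompleteSpace H]
  {A : H →ₗ.[ℝ] H} {c β F Q : ℝ} {f : ℝ → H} {f' g : ℝ → HScaleDual A 1}
  {u : ℝ → HScale A 2} {v θ : ℝ → H} {ι : Type*} {b : HilbertBasis ι ℝ H} {lam : ι → ℝ}

/-- Every weak solution is eventually absorbed, after a time linear in its initial energy. -/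
theorem IsWeakSolution.energy_le_of_le [Countable ι] (h : IsEigenbasis A c b lam)
    (hsol : IsWeakSolution A β f g u v θ) (hf : EssBoundedBy f F) (hd : IsDistribDeriv A f f')
    (hT : TranslationBoundedBy A f' g Q) (hF0 : 0 ≤ F) (hQ0 : 0 ≤ Q) {M : ℝ} (hM : 2 ≤ M)
    (hβ : |β| ≤ M) (hc : c⁻¹ ≤ M) (hF : F ≤ M) (hQ : Q ≤ M) {R t : ℝ}
    (hR : energy β (u 0) (v 0) (θ 0) ≤ R) (ht : 6 * R ≤ t) :
    energy β (u t) (v t) (θ t) ≤ 4 * (163840 * M ^ 3) ^ 4 := by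
  refine le_of_decreasing_at_large_values (hsol.continuousOn_energy h)
    (fun t _ => energy_nonneg _ _ _) (by positivity) (fun K hK a T ha haT hE => ?_) hR ht
  have hK0 : 0 ≤ K := le_trans (by positivity) hK
  obtain ⟨k, hk0, rfl⟩ : ∃ k : ℝ, 0 ≤ k ∧ k ^ 4 = K :=
    ⟨√(√K), Real.sqrt_nonneg _, by
      rw [show 4 = 2 * 2 from rfl, pow_mul, Real.sq_sqrt (Real.sqrt_nonneg _), Real.sq_sqrt hK0]⟩
  have hk : 163840 * M ^ 3 ≤ k := le_of_pow_le_pow_left₀ (by norm_num) hk0 hK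
  exact hsol.energy_le_sub h hf hd hT hF0 hQ0 ha haT hM hβ hc hF hQ hk hE

theorem IsEigenbasis.normOneSq_le (h : IsEigenbasis A c b lam) {M : ℝ} (hM : 1 ≤ M) (hc : c⁻¹ ≤ M)
    (x : HScale A 2) : normOneSq x ≤ M * ‖x‖ ^ 2 := by
  refine hasSum_le (fun i => ?_) (h.hasSum_normOneSq x) ((h.hasSum_norm_sq x).mul_left M)
  have h1 := h.le_sqrt_lam hM hc i
  calc √(lam i) * ⟪b i, x.incl⟫_ℝ ^ 2
      ≤ (M * √(lam i)) * (√(lam i) * ⟪b i, x.incl⟫_ℝ ^ 2) :=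
        le_mul_of_one_le_left (by positivity) h1
    _ = M * (√(lam i) * ⟪b i, x.incl⟫_ℝ) ^ 2 := by ring

/-- On bounded sets of the phase space the energy grows at most like the fourth power. -/
theorem IsEigenbasis.energy_le_of_phaseNorm_le (h : IsEigenbasis A c b lam) {M R : ℝ} (hM : 2 ≤ M)
    (hβ : |β| ≤ M) (hc : c⁻¹ ≤ M) {x : HScale A 2} {y z : H}
    (hx : phaseNorm x y z ≤ R) :
    energy β x y z ≤ 1 / 2 * R ^ 2 + 1 / 4 * (M * (1 + R ^ 2)) ^ 2 := by
  have h1 : phaseNorm x y z ^ 2 ≤ R ^ 2 := pow_le_pow_left₀ (Real.sqrt_nonneg _) hx 2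
  have h2 : normOneSq x ≤ M * R ^ 2 := by
    refine (h.normOneSq_le (by linarith) hc x).trans (mul_le_mul_of_nonneg_left ?_ (by linarith))
    rw [phaseNorm_sq] at h1
    linarith [sq_nonneg ‖y‖, sq_nonneg ‖z‖]
  have h3 : (β + normOneSq x) ^ 2 ≤ (M * (1 + R ^ 2)) ^ 2 := by
    have h4 : 0 ≤ normOneSq x := IsEigenbasis.normOneSq_nonneg x
    have h5 : 0 ≤ M * R ^ 2 := by positivity
    refine sq_le_sq' ?_ ?_
    · linarith [neg_abs_le β]
    · linarith [le_abs_self β]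
  rw [energy]
  linarith

end Absorbing

theorem absorbing_radius_le {M : ℝ} (hM : 2 ≤ M) : 2 * (4 * (163840 * M ^ 3) ^ 4) ≤ M ^ 100 := by
  have hM0 : 0 ≤ M := by linarith
  have h1 : (2 : ℝ) ^ 75 ≤ M ^ 75 := by gcongr
  calc 2 * (4 * (163840 * M ^ 3) ^ 4) = 8 * 163840 ^ 4 * M ^ 12 := by ring
    _ ≤ 2 ^ 75 * M ^ 12 := by gcongr; norm_num
    _ ≤ M ^ 75 * M ^ 12 := by gcongr
    _ = M ^ 87 := by ring
    _ ≤ M ^ 100 := pow_le_pow_right₀ (by linarith) (by norm_num)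

theorem entering_time_le {M R : ℝ} (hM : 2 ≤ M) (hR : 0 ≤ R) :
    6 * R ≤ (M * (1 + R)) ^ 100 ∧
      6 * (1 / 2 * R ^ 2 + 1 / 4 * (M * (1 + R ^ 2)) ^ 2) ≤ (M * (1 + R)) ^ 100 := by
  obtain ⟨X, hX⟩ : ∃ X, X = M * (1 + R) := ⟨_, rfl⟩
  rw [← hX]
  have hRX : 2 * (1 + R) ≤ X := by rw [hX]; gcongr
  have hX2 : 2 ≤ X := by linarith
  have h1 : X ^ 6 ≤ X ^ 100 := pow_le_pow_right₀ (by linarith) (by norm_num)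
  have h2 : 2 ^ 2 ≤ X ^ 2 := by gcongr
  have h3 : 2 ^ 2 * X ^ 2 ≤ X ^ 2 * X ^ 2 := by gcongr
  have h4 : 2 ^ 2 * X ^ 4 ≤ X ^ 2 * X ^ 4 := by gcongr
  have h5 : M * (1 + R ^ 2) ≤ X ^ 2 := by
    calc M * (1 + R ^ 2) ≤ M * (1 + R) ^ 2 := by gcongr; linarith
      _ ≤ (M * M) * (1 + R) ^ 2 := by gcongr; exact le_mul_of_one_le_left (by linarith) (by linarith)
      _ = X ^ 2 := by rw [hX]; ring
  have h6 : (M * (1 + R ^ 2)) ^ 2 ≤ (X ^ 2) ^ 2 := by gcongr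
  have h7 : R ^ 2 ≤ X ^ 2 := by gcongr; linarith
  have h8 : 0 ≤ X ^ 2 := sq_nonneg X
  have h9 : 2 * X ≤ X * X := by gcongr
  refine ⟨le_trans ?_ h1, le_trans ?_ h1⟩ <;> linarith

/-- Absorption with the explicit radius `M ^ 100` and the explicit time `(M * (1 + R)) ^ 100`, for
every upper bound `M ≥ 2` of the data. -/
theorem IsWeakSolution.absorbed {H : Type*} [NormedAddCommGroup H] [InnerProductSpace ℝ H]
    [CompleteSpace H] {A : H →ₗ.[ℝ] H} {c β F Q : ℝ} {f : ℝ → H} {f' g : ℝ → HScaleDual A 1}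
    {u : ℝ → HScale A 2} {v θ : ℝ → H} {ι : Type*} {b : HilbertBasis ι ℝ H} {lam : ι → ℝ}
    [Countable ι] (h : IsEigenbasis A c b lam)
    (hsol : IsWeakSolution A β f g u v θ) (hf : EssBoundedBy f F) (hd : IsDistribDeriv A f f')
    (hT : TranslationBoundedBy A f' g Q) (hF0 : 0 ≤ F) (hQ0 : 0 ≤ Q) {M : ℝ} (hM : 2 ≤ M)
    (hβ : |β| ≤ M) (hc : c⁻¹ ≤ M) (hF : F ≤ M) (hQ : Q ≤ M) {R : ℝ} (hR : 0 ≤ R) :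
    (energy β (u 0) (v 0) (θ 0) ≤ R →
      ∀ t : ℝ, (M * (1 + R)) ^ 100 ≤ t → energy β (u t) (v t) (θ t) ≤ M ^ 100) ∧
    (phaseNorm (u 0) (v 0) (θ 0) ≤ R →
      ∀ t : ℝ, (M * (1 + R)) ^ 100 ≤ t → phaseNorm (u t) (v t) (θ t) ≤ M ^ 100) := by
  have hR₀ := absorbing_radius_le hM
  have hpos : 0 ≤ 4 * (163840 * M ^ 3) ^ 4 := by positivity
  have hone : 1 ≤ M ^ 100 := one_le_pow₀ (by linarith)
  constructor
  · intro hE t ht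
    have := hsol.energy_le_of_le h hf hd hT hF0 hQ0 hM hβ hc hF hQ hE
      ((entering_time_le hM hR).1.trans ht)
    linarith
  · intro hE t ht
    have h1 := hsol.energy_le_of_le h hf hd hT hF0 hQ0 hM hβ hc hF hQ
      (h.energy_le_of_phaseNorm_le hM hβ hc hE) ((entering_time_le hM hR).2.trans ht)
    have h2 : phaseNorm (u t) (v t) (θ t) ^ 2 ≤ M ^ 100 := by
      rw [energy] at h1
      linarith [sq_nonneg (β + normOneSq (u t))]
    -- `M ^ 100 ≤ (M ^ 100) ^ 2`, since `M ^ 100 ≥ 1`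
    exact le_of_pow_le_pow_left₀ two_ne_zero (by linarith)
      (h2.trans (le_self_pow₀ hone two_ne_zero))

theorem theorem3p1 :
    -- `N` is an absolute constant: `R₀` and `t₀` are given by explicit formulas in the data
    ∃ N : ℕ, ∀ (H : Type*) [NormedAddCommGroup H] [InnerProductSpace ℝ H] [CompleteSpace H]
      [TopologicalSpace.SeparableSpace H] (A : H →ₗ.[ℝ] H) (c β F Q : ℝ)
      (f : ℝ → H) (f' g : ℝ → HScaleDual A 1),
      IsStrictlyPositiveOp A c → 0 ≤ F → 0 ≤ Q →
      EssBoundedBy f F → IsDistribDeriv A f f' → TranslationBoundedBy A f' g Q →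
      let M : ℝ := 2 + |β| + c⁻¹ + F + Q
      let R₀ : ℝ := M ^ N
      let t₀ : ℝ → ℝ := fun R => (M * (1 + R)) ^ N
      0 < R₀ ∧ ∀ R : ℝ, 0 ≤ R → 0 ≤ t₀ R ∧
        ∀ (u : ℝ → HScale A 2) (v θ : ℝ → H), IsWeakSolution A β f g u v θ →
          (energy β (u 0) (v 0) (θ 0) ≤ R →
            ∀ t : ℝ, t₀ R ≤ t → energy β (u t) (v t) (θ t) ≤ R₀) ∧
          (phaseNorm (u 0) (v 0) (θ 0) ≤ R →
            ∀ t : ℝ, t₀ R ≤ t → phaseNorm (u t) (v t) (θ t) ≤ R₀) := by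
  refine ⟨100, ?_⟩
  intro H _ _ _ _ A c β F Q f f' g hA hF0 hQ0 hf hd hT M R₀ t₀
  obtain ⟨s, b, lam, hlam, hmem⟩ := hA.exists_eigenbasis
  have h : IsEigenbasis A c b lam := ⟨hA, hlam, hmem⟩
  have : Countable s := b.orthonormal.countable_of_separable
  have hc0 : 0 < c⁻¹ := inv_pos.mpr hA.pos
  have hβ0 := abs_nonneg β
  have hM : 2 ≤ M := by simp only [M]; linarith
  have hβ : |β| ≤ M := by simp only [M]; linarith
  have hc : c⁻¹ ≤ M := by simp only [M]; linarith
  have hF : F ≤ M := by simp only [M]; linarith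
  have hQ : Q ≤ M := by simp only [M]; linarith
  have hM0 : 0 ≤ M := by linarith
  exact ⟨pow_pos (by linarith) 100, fun R hR => ⟨pow_nonneg (by positivity) 100,
    fun u v θ hsol => hsol.absorbed h hf hd hT hF0 hQ0 hM hβ hc hF hQ hR⟩⟩
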